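/- For $\mathbf a=(a_1,a_2,a_3,a_4)\in\mathbb C^4$ let $$P(x_1,x_2,x_3)=x_1^2+x_2^2+x_3^2+x_1x_2x_3-(a_1x_1+a_2x_2+a_3x_3+a_4),\qquad S_{\mathbf a}=\{P=0\}\subset\mathbb C^3 .$$ For $\{i,j,k\}=\{1,2,3\}$ let $\sigma_i$ be the involution of $S_{\mathbf a}$ that replaces $x_i$ by $a_i-x_i-x_jx_k$ and keeps $x_j,x_k$, and let $\Gamma_2=\langle\sigma_1\circ\sigma_2,\ \sigma_2\circ\sigma_3\rangle$, a group of bijections of $S_{\mathbf a}$. With $P_{x_i}=\partial P/\partial x_i$, the smooth part $\{(P_{x_1},P_{x_2},P_{x_3})\neq 0\}$ of $S_{\mathbf a}$ carries the holomorphic symplectic form $$\Omega=\frac{dx_1\wedge dx_2}{P_{x_3}}=\frac{dx_2\wedge dx_3}{P_{x_1}}=\frac{dx_3\wedge dx_1}{P_{x_2}},$$ and the (singular) foliations $\mathcal F_i=\ker(dx_i|_{S_{\mathbf a}})$, $i=1,2,3$; a point is regular for the $3$-web $(\mathcal F_1,\mathcal F_2,\mathcal F_3)$ if the three foliations are pairwise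 transversal there. A symplectic affine structure on a subset $S^o\subset S_{\mathbf a}$ is an atlas of holomorphic charts, with values in $\mathbb C^2$ and with domains in $S^o$, covering the smooth points of $S_{\mathbf a}$ in $S^o$, which send $\Omega$ to $du\wedge dv$ and whose transition maps are locally restrictions of elements of $$\mathrm{Aff}^1=\{(u,v)\mapsto(au+bv+t,\ cu+dv+s)\ :\ a,b,c,d,s,t\in\mathbb C,\ ad-bc=1\}.$$ It is invariant under a group $G$ of bijections of $S_{\mathbf a}$ if each $g\in G$, read in the charts wherever this makes sense, is locally the restriction of an element of $\mathrm{Aff}^1$. **Theorem.** Suppose that a non-empty Zariski open subset $S^o\subset S_{\mathbf a}$ carries a symplectic affine structure that is invariant under a subgroup $G\leq\Gamma_2$ of finite index. Then: 1. The $3$-web $(\mathcal F_1,\mathcal F_2,\mathcal F_3)$ is parallel through the affine charts: for every chart of the structure and every connected open subset $V$ of its image in $\mathbb C^2$ there are constant, pairwise linearly independent $1$-forms $\omega_i=\alpha_i\,du+\beta_i\,dv$, $i=1,2,3$, such that at every point of $V$ at which $\mathcal F_i$ is not singular, $\mathcal F_i$ is sent by the chart to $\ker\omega_i$. In other words, each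 $\mathcal F_i$ is a foliation by parallel lines in the affine charts. 2. The $3$-web on $S_{\mathbf a}$ is locally parallelizable: every regular point of the web lies in the domain of a holomorphic chart in which the three foliations are the kernels of three constant, pairwise linearly independent $1$-forms. 3. $\mathbf a=(0,0,0,4)$. In particular, $(S_{\mathbf a},\Gamma_2)$ admits an invariant symplectic affine structure only if $\mathbf a=(0,0,0,4)$. -/

import Mathlib

open Topology

noncomputable section

namespace CubicWeb

/-- The polynomial `x₁² + x₂² + x₃² + x₁x₂x₃ - (a₁x₁ + a₂x₂ + a₃x₃ + a₄)`. Indices start at `0`: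
`x 0, x 1, x 2` are the coordinates of `ℂ³` and `a 0, …, a 3` the parameters. -/
def cubic (a : Fin 4 → ℂ) (x : Fin 3 → ℂ) : ℂ :=
  x 0 ^ 2 + x 1 ^ 2 + x 2 ^ 2 + x 0 * x 1 * x 2
    - (a 0 * x 0 + a 1 * x 1 + a 2 * x 2 + a 3)

/-- The cubic surface `S_a ⊆ ℂ³`. -/
def surface (a : Fin 4 → ℂ) : Set (Fin 3 → ℂ) := {x | cubic a x = 0}

/-- The partial derivative `2xᵢ + xⱼxₖ - aᵢ` of `cubic a` in the direction `i`, where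
`{i, j, k} = {0, 1, 2}` (addition in `Fin 3` is modulo `3`). -/
def grad (a : Fin 4 → ℂ) (x : Fin 3 → ℂ) (i : Fin 3) : ℂ :=
  2 * x i + x (i + 1) * x (i + 2) - a i.castSucc

/-- `p` is a smooth point of `S_a`. -/
def IsSmoothPt (a : Fin 4 → ℂ) (p : surface a) : Prop := grad a p ≠ 0

/-- The involution `σᵢ`, replacing `xᵢ` by `aᵢ - xᵢ - xⱼxₖ`, on the ambient space `ℂ³`. -/
def sigmaFun (a : Fin 4 → ℂ) (i : Fin 3) (x : Fin 3 → ℂ) : Fin 3 → ℂ :=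
  Function.update x i (a i.castSucc - x i - x (i + 1) * x (i + 2))

theorem sigmaFun_mem (a : Fin 4 → ℂ) (i : Fin 3) {x : Fin 3 → ℂ} (hx : x ∈ surface a) :
    sigmaFun a i x ∈ surface a := by
  simp only [surface, Set.mem_ofPred_eq, cubic] at hx ⊢
  fin_cases i <;> simp [sigmaFun, Function.update] <;> linear_combination hx

theorem sigmaFun_sigmaFun (a : Fin 4 → ℂ) (i : Fin 3) (x : Fin 3 → ℂ) :
    sigmaFun a i (sigmaFun a i x) = x := by
  funext j
  fin_cases i <;> fin_cases j <;> simp [sigmaFun, Function.update] <;> ring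

/-- The involution `σᵢ` as a bijection of `S_a`. -/
def sigma (a : Fin 4 → ℂ) (i : Fin 3) : Equiv.Perm (surface a) where
  toFun p := ⟨sigmaFun a i p, sigmaFun_mem a i p.2⟩
  invFun p := ⟨sigmaFun a i p, sigmaFun_mem a i p.2⟩
  left_inv p := Subtype.ext (sigmaFun_sigmaFun a i p)
  right_inv p := Subtype.ext (sigmaFun_sigmaFun a i p)

/-- The group `Γ₂ = ⟨σ₁ ∘ σ₂, σ₂ ∘ σ₃⟩` of automorphisms of `S_a`. -/
def Gamma2 (a : Fin 4 → ℂ) : Subgroup (Equiv.Perm (surface a)) :=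
  Subgroup.closure {sigma a 0 * sigma a 1, sigma a 1 * sigma a 2}

/-- `U` is open in the Zariski topology of `S_a`: its complement is the common zero set in `S_a`
of a family of polynomials. -/
def IsZariskiOpen (a : Fin 4 → ℂ) (U : Set (surface a)) : Prop :=
  ∃ I : Set (MvPolynomial (Fin 3) ℂ),
    ∀ p : surface a, p ∉ U ↔ ∀ f ∈ I, MvPolynomial.eval (p : Fin 3 → ℂ) f = 0

/-- The kernel of the differential of `cubic a` at `x`; at a smooth point of `S_a` this is the
tangent plane of `S_a`. -/
def tangent (a : Fin 4 → ℂ) (x : Fin 3 → ℂ) : Submodule ℂ (Fin 3 → ℂ) :=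
  LinearMap.ker (∑ i : Fin 3, grad a x i • (LinearMap.proj i : (Fin 3 → ℂ) →ₗ[ℂ] ℂ))

/-- The direction `ker (dxᵢ)`, restricted to `S_a`, of the foliation `ℱᵢ` at `x`. It is a line,
except at the singular points of the foliation, where it is the whole tangent plane. -/
def foliation (a : Fin 4 → ℂ) (i : Fin 3) (x : Fin 3 → ℂ) : Submodule ℂ (Fin 3 → ℂ) :=
  tangent a x ⊓ LinearMap.ker (LinearMap.proj i : (Fin 3 → ℂ) →ₗ[ℂ] ℂ)

open Classical in
/-- The holomorphic symplectic form `Ω = dx₁ ∧ dx₂ / P₃ = dx₂ ∧ dx₃ / P₁ = dx₃ ∧ dx₁ / P₂` on the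
smooth part of `S_a`, where `Pᵢ = grad a x i`; one of the expressions with non-zero denominator is
used, and they agree on tangent vectors by `minor_eq_Omega_mul_grad`. -/
def Omega (a : Fin 4 → ℂ) (x v w : Fin 3 → ℂ) : ℂ :=
  if grad a x 2 ≠ 0 then (v 0 * w 1 - v 1 * w 0) / grad a x 2
  else if grad a x 0 ≠ 0 then (v 1 * w 2 - v 2 * w 1) / grad a x 0
  else (v 2 * w 0 - v 0 * w 2) / grad a x 1

theorem minor_eq_Omega_mul_grad (a : Fin 4 → ℂ) (x v w : Fin 3 → ℂ) (hx : grad a x ≠ 0)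
    (hv : v ∈ tangent a x) (hw : w ∈ tangent a x) (i : Fin 3) :
    v (i + 1) * w (i + 2) - v (i + 2) * w (i + 1) = Omega a x v w * grad a x i := by
  simp only [tangent, LinearMap.mem_ker, Fin.sum_univ_three, LinearMap.add_apply,
    LinearMap.smul_apply, LinearMap.proj_apply, smul_eq_mul] at hv hw
  unfold Omega
  by_cases h2 : grad a x 2 = 0
  · by_cases h0 : grad a x 0 = 0
    · have h1 : grad a x 1 ≠ 0 := by
        intro h1
        apply hx
        funext j
        fin_cases j <;> assumption
      rw [h0, h2, zero_mul, zero_mul, zero_add, add_zero] at hv hw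
      have hv1 : v 1 = 0 := (mul_eq_zero.mp hv).resolve_left h1
      have hw1 : w 1 = 0 := (mul_eq_zero.mp hw).resolve_left h1
      rw [if_neg (not_not.mpr h2), if_neg (not_not.mpr h0)]
      fin_cases i <;> simp [h0, h1, h2, hv1, hw1]
    · rw [h2, zero_mul, add_zero] at hv hw
      rw [if_neg (not_not.mpr h2), if_pos h0, div_mul_eq_mul_div, eq_div_iff h0]
      fin_cases i <;> simp [h2]
      · linear_combination v 2 * hw - w 2 * hv
      · left
        apply mul_left_cancel₀ h0
        linear_combination w 1 * hv - v 1 * hw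
  · rw [if_pos h2, div_mul_eq_mul_div, eq_div_iff h2]
    fin_cases i <;> simp
    · linear_combination v 1 * hw - w 1 * hv
    · linear_combination w 0 * hv - v 0 * hw

/-- A holomorphic chart of the smooth part of `S_a`: a homeomorphism from an open subset of `S_a`,
made of smooth points, onto an open subset of `ℂ²`, whose inverse is a holomorphic immersion into
`ℂ³`. -/
structure HolChart (a : Fin 4 → ℂ) where
  /-- The underlying homeomorphism between open subsets. -/
  toHomeo : OpenPartialHomeomorph (surface a) (ℂ × ℂ)
  smooth : ∀ p ∈ toHomeo.source, IsSmoothPt a p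
  holomorphic : DifferentiableOn ℂ (fun q => (toHomeo.symm q : Fin 3 → ℂ)) toHomeo.target
  immersion : ∀ q ∈ toHomeo.target,
    Function.Injective (fderiv ℂ (fun q => (toHomeo.symm q : Fin 3 → ℂ)) q)

/-- The inverse of a chart, as a map from `ℂ²` to `ℂ³`; it is meaningful on the target. -/
def HolChart.param {a : Fin 4 → ℂ} (c : HolChart a) (q : ℂ × ℂ) : Fin 3 → ℂ := c.toHomeo.symm q

/-- The chart sends `Ω` to `du ∧ dv`: the pull-back of `Ω` by the inverse of the chart takes the
value `1` on `(∂/∂u, ∂/∂v)`. -/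
def HolChart.IsSymplectic {a : Fin 4 → ℂ} (c : HolChart a) : Prop :=
  ∀ q ∈ c.toHomeo.target,
    Omega a (c.param q) (fderiv ℂ c.param q (1, 0)) (fderiv ℂ c.param q (0, 1)) = 1

/-- The symplectic affine group of `ℂ²`. -/
def Aff1 : Set (ℂ × ℂ → ℂ × ℂ) :=
  {f | ∃ a b c d t s : ℂ, a * d - b * c = 1 ∧
    f = fun q => (a * q.1 + b * q.2 + t, c * q.1 + d * q.2 + s)}

/-- A symplectic affine structure on (the smooth part of) a subset `U` of `S_a`: an atlas of
symplectic holomorphic charts whose transition maps are locally symplectic affine maps. -/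
structure AffineStructure (a : Fin 4 → ℂ) (U : Set (surface a)) where
  /-- The charts of the structure. -/
  atlas : Set (HolChart a)
  source_subset : ∀ c ∈ atlas, c.toHomeo.source ⊆ U
  cover : ∀ p ∈ U, IsSmoothPt a p → ∃ c ∈ atlas, p ∈ c.toHomeo.source
  symplectic : ∀ c ∈ atlas, c.IsSymplectic
  transition : ∀ c ∈ atlas, ∀ c' ∈ atlas, ∀ p ∈ c.toHomeo.source ∩ c'.toHomeo.source,
    ∃ f ∈ Aff1, ∀ᶠ p' in 𝓝 p, c'.toHomeo p' = f (c.toHomeo p')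

/-- Invariance of an affine structure under a group of transformations of `S_a`: read in the
charts, wherever this makes sense, every element of the group is locally a symplectic affine
map. (`U` itself need not be stable under the group.) -/
def AffineStructure.IsInvariant {a : Fin 4 → ℂ} {U : Set (surface a)} (A : AffineStructure a U)
    (G : Subgroup (Equiv.Perm (surface a))) : Prop :=
  ∀ g ∈ G, ∀ c ∈ A.atlas, ∀ c' ∈ A.atlas, ∀ p ∈ c.toHomeo.source, g p ∈ c'.toHomeo.source →
    ∃ f ∈ Aff1, ∀ᶠ p' in 𝓝 p, c'.toHomeo (g p') = f (c.toHomeo p')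

/-- In the part `V` of the target of the chart `c`, the foliation `ℱᵢ` is the foliation by the
parallel lines `ℓ = const`: the pull-back of its direction is `ker ℓ` at every point where `ℱᵢ`
is not singular. -/
def HolChart.IsParallel {a : Fin 4 → ℂ} (c : HolChart a) (V : Set (ℂ × ℂ)) (i : Fin 3)
    (l : ℂ × ℂ →ₗ[ℂ] ℂ) : Prop :=
  l ≠ 0 ∧ ∀ q ∈ V, foliation a i (c.param q) ≠ tangent a (c.param q) →
    (foliation a i (c.param q)).comap (fderiv ℂ c.param q : ℂ × ℂ →ₗ[ℂ] (Fin 3 → ℂ))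
      = LinearMap.ker l

/-- In the part `V` of the target of the chart `c`, the `3`-web `(ℱ₁, ℱ₂, ℱ₃)` is parallel: the
foliations are defined by three constant, pairwise linearly independent `1`-forms. -/
def HolChart.IsParallelWeb {a : Fin 4 → ℂ} (c : HolChart a) (V : Set (ℂ × ℂ)) : Prop :=
  ∃ l : Fin 3 → (ℂ × ℂ →ₗ[ℂ] ℂ),
    (∀ i, c.IsParallel V i (l i)) ∧ ∀ i j, i ≠ j → LinearIndependent ℂ ![l i, l j]

/-- `p` is a regular point of the `3`-web: a smooth point of `S_a` at which the three foliations
are pairwise transversal (in particular, none of them is singular there). -/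
def IsWebRegular (a : Fin 4 → ℂ) (p : surface a) : Prop :=
  IsSmoothPt a p ∧ ∀ i j, i ≠ j → foliation a i p ⊓ foliation a j p = ⊥

/-- The `3`-web `(ℱ₁, ℱ₂, ℱ₃)` on `S_a` is locally parallelizable: around each of its regular
points there is a holomorphic chart in which it is parallel. -/
def WebLocallyParallelizable (a : Fin 4 → ℂ) : Prop :=
  ∀ p : surface a, IsWebRegular a p →
    ∃ c : HolChart a, p ∈ c.toHomeo.source ∧ c.IsParallelWeb c.toHomeo.target

end CubicWeb

end

/-! Let `{i, j, k} = {0, 1, 2}` in cyclic order. The composition g = σⱼ ∘ σₖ preserves the fibration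
by conics xᵢ = const. Write xᵢ = t + t⁻¹. The quadratic part xⱼ² + xᵢxⱼxₖ + xₖ² splits as (xⱼ + t
xₖ)(xⱼ + t⁻¹xₖ), the conic becomes a hyperbola with parameter Z = xⱼ + t xₖ - center, and g
multiplies Z by t⁻². Near a point with t = t₀, put T = log (t / t₀) and ζ = log (Z / z₀). These are
coordinates with dT ∧ dζ = -Ω. If t₀ is a root of unity, a suitable power gᵐ fixes the conic of t₀
pointwise, lies in G by finiteness of the index, and reads (T, ζ) ↦ (T, ζ - 2mT).

In an affine chart gᵐ is an affine map with a fixed point. A local computation (`twist_linear`)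
shows that an affine map can be such a twist, in coordinates with constant Jacobian, only if (dT)²
has constant coefficients in the chart. As dxᵢ = (t - t⁻¹) dT, this says that the quadratic
differential (dxᵢ)² / (xᵢ² - 4) is constant in the chart
(`HolChart.IsSymplectic.hasConstDiff_of_twist`). Roots of unity are infinite in number, so such a
fibre meets `U`. The property is stable under affine changes of charts and propagates by the
identity principle, because the smooth part of `U` is connected
(`AffineStructure.IsInvariant.hasConstDiff`).

Hence dxᵢ = ρᵢ lᵢ with lᵢ a constant form and ρᵢ² = xᵢ² - 4: the web is parallel in the affine
charts. Moreover dx₀ ∧ dx₁ = P₂ du ∧ dv gives P₂² = K (x₀² - 4)(x₁² - 4) with K constant. On the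
surface P₂² is the discriminant of the cubic in x₂, a polynomial in x₀ and x₁; comparing
coefficients forces a = (0, 0, 0, 4) (`HolChart.IsSymplectic.parameters_eq`). For this Cayley cubic,
(u, v) ↦ (2 cos u, 2 cos v, -2 cos (u + v)) makes the web parallel explicitly. -/

namespace CubicWeb

/-! ### Holomorphic functions of two variables are analytic -/

section Osgood

open Metric

/-- A point of the circle with centre `c` and radius `R`, given by its angle. -/
noncomputable def circlePoint (c : ℂ) {R : ℝ} (hR : 0 ≤ R) : C(ℝ, sphere c R) where
  toFun θ := ⟨circleMap c R θ, circleMap_mem_sphere c hR θ⟩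
  continuous_toFun := (continuous_circleMap c R).subtype_mk _

/-- Integration over a circle, as a continuous functional. -/
noncomputable def circleFunctional (c : ℂ) {R : ℝ} (hR : 0 ≤ R) : C(sphere c R, ℂ) →L[ℂ] ℂ :=
  LinearMap.mkContinuous
    { toFun := fun k => ∫ θ in (0 : ℝ)..2 * Real.pi, deriv (circleMap c R) θ * k (circlePoint c hR θ)
      map_add' := fun k l => by
        rw [← intervalIntegral.integral_add]
        · simp [mul_add]
        all_goals
          apply Continuous.intervalIntegrable
          simp only [deriv_circleMap]
          fun_prop
      map_smul' := fun s k => by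
        rw [RingHom.id_apply, smul_eq_mul, ← intervalIntegral.integral_const_mul]
        congr 1
        funext θ
        simp
        ring } (R * |2 * Real.pi - 0|) (fun k => by
      have : ∀ θ ∈ Set.uIoc 0 (2 * Real.pi),
          ‖deriv (circleMap c R) θ * k (circlePoint c hR θ)‖ ≤ R * ‖k‖ := by
        intro θ _
        rw [norm_mul, deriv_circleMap]
        gcongr
        · simp [abs_of_nonneg hR]
        · exact k.norm_coe_le_norm _
      refine (intervalIntegral.norm_integral_le_of_norm_le_const this).trans (le_of_eq ?_)
      ring)

theorem circleFunctional_apply (c : ℂ) {R : ℝ} (hR : 0 ≤ R) (k : C(sphere c R, ℂ)) (g : ℂ → ℂ)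
    (hg : ∀ s : sphere c R, k s = g s) : circleFunctional c hR k = ∮ z in C(c, R), g z := by
  simp only [circleFunctional, LinearMap.mkContinuous_apply, LinearMap.coe_mk, AddHom.coe_mk,
    circleIntegral, hg, smul_eq_mul]
  rfl

/-- The Cauchy kernel `ζ ↦ (ζ - w)⁻¹`, as an element of the Banach algebra of continuous functions
on a circle. -/
noncomputable def cauchyKernel (c : ℂ) (R : ℝ) (w : ℂ) : C(sphere c R, ℂ) :=
  Ring.inverse ((⟨fun s => (s : ℂ), continuous_subtype_val⟩ : C(sphere c R, ℂ)) -
    algebraMap ℂ C(sphere c R, ℂ) w)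

theorem isUnit_sub_algebraMap {c : ℂ} {R : ℝ} {w : ℂ} (hw : w ∈ ball c R) :
    IsUnit ((⟨fun s => (s : ℂ), continuous_subtype_val⟩ : C(sphere c R, ℂ)) -
      algebraMap ℂ C(sphere c R, ℂ) w) := by
  rw [ContinuousMap.isUnit_iff_forall_ne_zero]
  intro s hs
  have h : (s : ℂ) = w := sub_eq_zero.mp (by simpa using hs)
  have h1 := s.2
  rw [h, mem_sphere] at h1
  exact absurd h1 (ne_of_lt (mem_ball.mp hw))

theorem cauchyKernel_apply {c : ℂ} {R : ℝ} {w : ℂ} (hw : w ∈ ball c R) (s : sphere c R) :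
    cauchyKernel c R w s = ((s : ℂ) - w)⁻¹ := by
  have h := congrArg (fun k : C(sphere c R, ℂ) => k s)
    (Ring.mul_inverse_cancel _ (isUnit_sub_algebraMap hw))
  have h' : ((s : ℂ) - w) * cauchyKernel c R w s = 1 := by simpa [cauchyKernel] using h
  exact eq_inv_of_mul_eq_one_right h'

theorem analyticAt_cauchyKernel {c : ℂ} {R : ℝ} {w : ℂ} (hw : w ∈ ball c R) :
    AnalyticAt ℂ (cauchyKernel c R) w := by
  obtain ⟨u, hu⟩ := isUnit_sub_algebraMap hw
  have h1 := analyticAt_inverse (𝕜 := ℂ) u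
  rw [hu] at h1
  have h2 : AnalyticAt ℂ (fun w : ℂ => (⟨fun s => (s : ℂ), continuous_subtype_val⟩ :
      C(sphere c R, ℂ)) - algebraMap ℂ C(sphere c R, ℂ) w) w :=
    analyticAt_const.sub ((Algebra.linearMap ℂ C(sphere c R, ℂ)).toContinuousLinearMap.analyticAt w)
  exact AnalyticAt.comp (g := Ring.inverse) (f := fun w : ℂ => (⟨fun s => (s : ℂ),
    continuous_subtype_val⟩ : C(sphere c R, ℂ)) - algebraMap ℂ C(sphere c R, ℂ) w) h1 h2

/-- Cauchy's formula in each variable. The formula in the second variable defines an analytic map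
`Φ` into the Banach algebra of continuous functions on the circle of the first variable. The formula
in the first variable then writes F(w₁, w₂) as a continuous functional of the product of
`cauchyKernel` at w₁ and `Φ` at w₂. The kernel is analytic because inversion in a Banach algebra is,
so F is jointly analytic. -/
theorem analyticAt_of_differentiableOn_polydisc {F : ℂ × ℂ → ℂ} {c : ℂ × ℂ} {R : ℝ} (hR : 0 < R)
    (hF : DifferentiableOn ℂ F (closedBall c.1 R ×ˢ closedBall c.2 R)) : AnalyticAt ℂ F c := by
  have hcl : IsClosed (closedBall c.1 R ×ˢ closedBall c.2 R) := isClosed_closedBall.prod isClosed_closedBall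
  -- Tietze extension: F is continuous only on the closed polydisc, and currying below needs a
  -- function continuous everywhere.
  obtain ⟨g, hg⟩ := ContinuousMap.exists_restrict_eq hcl ⟨_, hF.continuousOn.domRestrict⟩
  have hg' : ∀ q ∈ closedBall c.1 R ×ˢ closedBall c.2 R, g q = F q := fun q hq =>
    congrArg (fun k => k ⟨q, hq⟩) hg
  let G : C(ℂ, C(sphere c.1 R, ℂ)) :=
    ContinuousMap.curry ⟨fun q : ℂ × sphere c.1 R => g (q.2, q.1), by fun_prop⟩
  let Φ : ℂ → C(sphere c.1 R, ℂ) := fun w =>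
    (2 * Real.pi * Complex.I : ℂ)⁻¹ • ∮ z in C(c.2, R), (z - w)⁻¹ • G z
  have hΦ : AnalyticAt ℂ Φ c.2 := by
    have h := hasFPowerSeriesOn_cauchy_integral (f := G) (c := c.2) (R := ⟨R, hR.le⟩)
      (G.continuous.continuousOn.circleIntegrable hR.le) hR
    exact h.analyticAt
  have hΦe : ∀ w ∈ ball c.2 R, ∀ s : sphere c.1 R, Φ w s = F (s, w) := by
    intro w hw s
    have hs : (s : ℂ) ∈ closedBall c.1 R := sphere_subset_closedBall s.2
    have hint : IntervalIntegrable (fun θ => deriv (circleMap c.2 R) θ •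
        ((circleMap c.2 R θ - w)⁻¹ • G (circleMap c.2 R θ))) MeasureTheory.volume 0 (2 * Real.pi) := by
      refine CircleIntegrable.out (f := fun z => (z - w)⁻¹ • G z) ?_
      refine ContinuousOn.circleIntegrable hR.le ?_
      refine ContinuousOn.smul (ContinuousOn.inv₀
        (continuousOn_id.sub continuousOn_const) ?_) G.continuous.continuousOn
      intro z hz h0
      have h0' : z = w := sub_eq_zero.mp h0
      rw [h0', mem_sphere] at hz
      exact absurd hz (ne_of_lt (mem_ball.mp hw))
    have h1 : (∮ z in C(c.2, R), (z - w)⁻¹ • G z) s = ∮ z in C(c.2, R), (z - w)⁻¹ • F (s, z) := by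
      have h2 := ContinuousLinearMap.intervalIntegral_comp_comm
        (ContinuousMap.evalCLM ℂ s) hint
      rw [circleIntegral, circleIntegral]
      refine h2.symm.trans ?_
      congr 1
      funext θ
      have h3 : G (circleMap c.2 R θ) s = F (s, circleMap c.2 R θ) :=
        hg' _ ⟨hs, sphere_subset_closedBall (circleMap_mem_sphere _ hR.le θ)⟩
      simp [h3]
    have h4 : DifferentiableOn ℂ (fun z => F (s, z)) (closedBall c.2 R) :=
      hF.comp (by fun_prop) (fun z hz => ⟨hs, hz⟩)
    have h5 := h4.circleIntegral_sub_inv_smul hw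
    simp only [Φ, ContinuousMap.smul_apply, h1, h5]
    rw [smul_smul, inv_mul_cancel₀ Complex.two_pi_I_ne_zero, one_smul]
  have hmain : ∀ q ∈ ball c.1 R ×ˢ ball c.2 R, F q = (2 * Real.pi * Complex.I : ℂ)⁻¹ *
      circleFunctional c.1 hR.le (cauchyKernel c.1 R q.1 * Φ q.2) := by
    rintro ⟨w₁, w₂⟩ ⟨h₁, h₂⟩
    rw [circleFunctional_apply c.1 hR.le _ (fun z => (z - w₁)⁻¹ • F (z, w₂)) (fun s => by
      rw [ContinuousMap.mul_apply, cauchyKernel_apply h₁, hΦe w₂ h₂, smul_eq_mul])]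
    have h4 : DifferentiableOn ℂ (fun z => F (z, w₂)) (closedBall c.1 R) :=
      hF.comp (by fun_prop) (fun z hz => ⟨hz, ball_subset_closedBall h₂⟩)
    rw [h4.circleIntegral_sub_inv_smul h₁, smul_eq_mul, ← mul_assoc,
      inv_mul_cancel₀ Complex.two_pi_I_ne_zero, one_mul]
  have hE : (fun q : ℂ × ℂ => (2 * Real.pi * Complex.I : ℂ)⁻¹ *
      circleFunctional c.1 hR.le (cauchyKernel c.1 R q.1 * Φ q.2)) =ᶠ[𝓝 c] F := by
    filter_upwards [prod_mem_nhds (ball_mem_nhds c.1 hR) (ball_mem_nhds c.2 hR)] with q hq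
    exact (hmain q hq).symm
  refine AnalyticAt.congr ?_ hE
  have hk : AnalyticAt ℂ (fun q : ℂ × ℂ => cauchyKernel c.1 R q.1) c :=
    AnalyticAt.fun_comp (analyticAt_cauchyKernel (mem_ball_self hR)) analyticAt_fst
  have hp : AnalyticAt ℂ (fun q : ℂ × ℂ => Φ q.2) c := AnalyticAt.fun_comp hΦ analyticAt_snd
  exact analyticAt_const.mul
    (((circleFunctional c.1 hR.le).analyticAt _).fun_comp (hk.mul hp))

/-- A holomorphic function on an open subset of `ℂ²` is analytic. -/
theorem analyticOnNhd_of_differentiableOn {F : ℂ × ℂ → ℂ} {s : Set (ℂ × ℂ)} (hs : IsOpen s)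
    (hF : DifferentiableOn ℂ F s) : AnalyticOnNhd ℂ F s := by
  intro c hc
  obtain ⟨R, hR, h⟩ := Metric.nhds_basis_closedBall.mem_iff.mp (hs.mem_nhds hc)
  refine analyticAt_of_differentiableOn_polydisc hR (hF.mono ?_)
  rwa [closedBall_prod_same]

end Osgood

/-! ### Holomorphic maps conjugating an affine map to a linear twist -/

section Twist

theorem exists_polynomial_eval_eq_multilinear {E : Type*} [NormedAddCommGroup E] [NormedSpace ℂ E]
    {d : ℕ} (p : E [×d]→L[ℂ] ℂ) (w v : E) :
    ∃ P : Polynomial ℂ, ∀ s : ℂ, P.eval s = p (fun _ => w + s • v) := by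
  classical
  refine ⟨∑ S : Finset (Fin d), Polynomial.C (p (S.piecewise (fun _ => w) (fun _ => v))) *
    ∏ i, (if i ∈ S then 1 else Polynomial.X), fun s => ?_⟩
  have h : (fun _ : Fin d => w + s • v) = (fun _ => w) + (fun _ => s • v) := rfl
  rw [h, p.map_add_univ, Polynomial.eval_finsetSum]
  refine Finset.sum_congr rfl fun S _ => ?_
  have h2 : S.piecewise (fun _ => w) (fun _ => s • v) =
      fun i => (if i ∈ S then (1 : ℂ) else s) • S.piecewise (fun _ => w) (fun _ => v) i := by
    funext i
    by_cases hi : i ∈ S <;> simp [hi]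
  rw [h2, p.map_smul_univ, Polynomial.eval_mul, Polynomial.eval_C, Polynomial.eval_prod, mul_comm,
    smul_eq_mul]
  congr 1
  refine Finset.prod_congr rfl fun i _ => ?_
  by_cases hi : i ∈ S <;> simp [hi]

theorem eval_eq_add_mul_of_nat {P : Polynomial ℂ} {α β : ℂ}
    (h : ∀ k : ℕ, P.eval (k : ℂ) = α + k * β) (s : ℂ) : P.eval s = α + s * β := by
  have h1 : P = Polynomial.C α + Polynomial.X * Polynomial.C β := by
    refine Polynomial.eq_of_infinite_eval_eq _ _ (Set.infinite_of_injective_forall_mem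
      (f := fun k : ℕ => (k : ℂ)) Nat.cast_injective fun k => ?_)
    simpa [mul_comm β] using h k
  rw [h1, Polynomial.eval_add, Polynomial.eval_mul, Polynomial.eval_C, Polynomial.eval_C,
    Polynomial.eval_X]

/-- Taylor coefficients of functions related by a linear change of variables. -/
theorem HasFPowerSeriesAt.apply_map_eq {E : Type*} [NormedAddCommGroup E] [NormedSpace ℂ E]
    {f g : E → ℂ} {p r : FormalMultilinearSeries ℂ E ℂ} (hf : HasFPowerSeriesAt f p 0)
    (hg : HasFPowerSeriesAt g r 0) (A : E →L[ℂ] E) (N : ℂ)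
    (h : ∀ᶠ w in 𝓝 0, f (A w) = f w + N * g w) (d : ℕ) (w : E) :
    p d (fun _ => A w) = p d (fun _ => w) + N * r d (fun _ => w) := by
  have hA : HasFPowerSeriesAt (f ∘ A) (p.compContinuousLinearMap A) 0 := by
    obtain ⟨ρ, hρ⟩ := hf
    rw [← map_zero A] at hρ
    exact ⟨_, hρ.compContinuousLinearMap⟩
  have h0 := (hA.sub (hf.add (hg.const_smul (c := N)))).congr (g := 0) (by
    filter_upwards [h] with w hw
    simp [hw])
  have h1 := h0.apply_eq_zero d w
  have h2 : p d (fun _ => A w) - (p d (fun _ => w) + N * r d (fun _ => w)) = 0 := by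
    simpa [Function.comp_def] using h1
  exact sub_eq_zero.mp h2

theorem pow_apply_of_sq_zero {E : Type*} [NormedAddCommGroup E] [NormedSpace ℂ E]
    (A n : E →L[ℂ] E) (hA : ∀ w, A w = w + n w) (hn : ∀ w, n (n w) = 0) (k : ℕ) (w : E) :
    A (w + (k : ℂ) • n w) = w + ((k + 1 : ℕ) : ℂ) • n w := by
  rw [hA, map_add, map_smul, hn, smul_zero, add_zero, add_assoc]
  push_cast
  rw [add_smul, one_smul]

/-- Passage from discrete to complex time. Since n² = 0, the iterates of A = 1 + n are w ↦ w + k n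
w, so the identity holds for s = k ∈ ℕ by induction. Both sides are polynomial in s, hence they
agree for every complex s. -/
theorem coeff_flow {E : Type*} [NormedAddCommGroup E] [NormedSpace ℂ E]
    {d : ℕ} {p r : E [×d]→L[ℂ] ℂ} (A n : E →L[ℂ] E) (hA : ∀ w, A w = w + n w)
    (hn : ∀ w, n (n w) = 0) (N : ℂ)
    (hp : ∀ w, p (fun _ => A w) = p (fun _ => w) + N * r (fun _ => w))
    (hr : ∀ w, r (fun _ => A w) = r (fun _ => w)) (w : E) (s : ℂ) :
    p (fun _ => w + s • n w) = p (fun _ => w) + s * (N * r (fun _ => w)) := by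
  have hrk : ∀ k : ℕ, r (fun _ => w + (k : ℂ) • n w) = r (fun _ => w) := by
    intro k
    induction k with
    | zero => simp
    | succ k ih => rw [← pow_apply_of_sq_zero A n hA hn, hr, ih]
  have hpk : ∀ k : ℕ, p (fun _ => w + (k : ℂ) • n w) = p (fun _ => w) +
      k * (N * r (fun _ => w)) := by
    intro k
    induction k with
    | zero => simp
    | succ k ih =>
      rw [← pow_apply_of_sq_zero A n hA hn, hp, hrk, ih]
      push_cast
      ring
  obtain ⟨P, hP⟩ := exists_polynomial_eval_eq_multilinear p w (n w)
  rw [← hP]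
  exact eval_eq_add_mul_of_nat (fun k => by rw [hP, hpk]) s

/-- The differentiated form of the invariance of `f` and `g` under a unipotent linear map. -/
theorem fderiv_apply_nilpotent {E : Type*} [NormedAddCommGroup E] [NormedSpace ℂ E]
    {f g : E → ℂ} (hf : AnalyticAt ℂ f 0) (hg : AnalyticAt ℂ g 0)
    (A n : E →L[ℂ] E) (hA : ∀ w, A w = w + n w) (hn : ∀ w, n (n w) = 0) (N : ℂ)
    (hfA : ∀ᶠ w in 𝓝 0, f (A w) = f w + N * g w) (hgA : ∀ᶠ w in 𝓝 0, g (A w) = g w) :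
    ∀ᶠ w in 𝓝 0, fderiv ℂ f w (n w) = N * g w := by
  obtain ⟨p, hp⟩ := hf
  obtain ⟨r, hr⟩ := hg
  have hpc := HasFPowerSeriesAt.apply_map_eq hp hr A N hfA
  have hrc : ∀ (d : ℕ) (w : E), r d (fun _ => A w) = r d (fun _ => w) := by
    intro d w
    simpa using HasFPowerSeriesAt.apply_map_eq hr hr A 0 (by simpa using hgA) d w
  filter_upwards [hp.eventually_hasSum, hr.eventually_hasSum,
    hp.eventually_hasSum.eventually_nhds, hp.analyticAt.eventually_analyticAt] with w hw1 hw2 hw3 hw4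
  have hline : Filter.Tendsto (fun s : ℂ => w + s • n w) (𝓝 0) (𝓝 w) := by
    have : Continuous fun s : ℂ => w + s • n w := by fun_prop
    simpa using this.tendsto 0
  -- Summing the identities of `coeff_flow` over the degree turns the discrete invariance into an
  -- affine dependence on s along the line w + s n w; the claim is its derivative at s = 0.
  have hev : (fun s : ℂ => f (w + s • n w)) =ᶠ[𝓝 0] fun s => f w + s * (N * g w) := by
    filter_upwards [hline.eventually hw3] with s hs
    rw [zero_add] at hs hw1 hw2
    refine hs.unique ?_
    have h1 := hw1.add (hw2.mul_left (s * N))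
    rw [mul_assoc] at h1
    convert h1 using 2 with d
    rw [coeff_flow A n hA hn N (hpc d) (hrc d), mul_assoc]
  have hd1 : HasDerivAt (fun s : ℂ => f (w + s • n w)) (fderiv ℂ f w (n w)) 0 := by
    have hl : HasDerivAt (fun s : ℂ => w + s • n w) (n w) 0 := by
      simpa using ((hasDerivAt_id (0 : ℂ)).smul_const (n w)).const_add w
    have hfd : HasFDerivAt f (fderiv ℂ f w) (w + (0 : ℂ) • n w) := by
      simpa using hw4.differentiableAt.hasFDerivAt
    exact hfd.comp_hasDerivAt (0 : ℂ) hl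
  have hd2 : HasDerivAt (fun s : ℂ => f w + s * (N * g w)) (N * g w) 0 := by
    simpa using ((hasDerivAt_id (0 : ℂ)).mul_const (N * g w)).const_add (f w)
  exact (hd1.congr_of_eventuallyEq hev.symm).unique hd2

/-- Write A = 1 + n. Differentiating at 0 gives dT ∘ n = 0 and dζ ∘ n = N dT, so n² = 0 because dT
and dζ are independent. By `fderiv_apply_nilpotent`, dT(n w) = 0 and dζ(n w) = N T(w) near 0. Taking
y = n w in the Jacobian identity yields N T(w) dT_w(x) = ε b(x, w) with b(x, w) = det(x, n w).
Integration gives N T² = ε b(w, w), and b has rank at most one, so that (dT_w x)² = (ε / N) b(x, x),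
which is independent of w. -/
theorem twist_linear {T ζ : ℂ × ℂ → ℂ} (hT : AnalyticAt ℂ T 0) (hζ : AnalyticAt ℂ ζ 0)
    {ε N : ℂ} (hε : ε ≠ 0) (hN : N ≠ 0)
    (hdet : ∀ᶠ w in 𝓝 0, ∀ x y, fderiv ℂ T w x * fderiv ℂ ζ w y - fderiv ℂ T w y * fderiv ℂ ζ w x
      = ε * (x.1 * y.2 - x.2 * y.1))
    (A : ℂ × ℂ →L[ℂ] ℂ × ℂ) {k l m o : ℂ} (hA1 : k * o - l * m = 1)
    (hA : ∀ w, A w = (k * w.1 + l * w.2, m * w.1 + o * w.2))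
    (hTA : ∀ᶠ w in 𝓝 0, T (A w) = T w) (hζA : ∀ᶠ w in 𝓝 0, ζ (A w) = ζ w + N * T w) :
    ∃ β : ℂ × ℂ → ℂ, ∀ᶠ w in 𝓝 0, ∀ x, fderiv ℂ T w x ^ 2 = β x := by
  have hT0 : T 0 = 0 := by
    have h := hζA.self_of_nhds
    rw [map_zero] at h
    have h2 : N * T 0 = 0 := by linear_combination -h
    exact (mul_eq_zero.mp h2).resolve_left hN
  set n : ℂ × ℂ →L[ℂ] ℂ × ℂ := A - ContinuousLinearMap.id ℂ (ℂ × ℂ) with hn_def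
  have hAn : ∀ w, A w = w + n w := fun w => by simp [hn_def]
  have hnw : ∀ w, n w = ((k - 1) * w.1 + l * w.2, m * w.1 + (o - 1) * w.2) := fun w => by
    rw [hn_def, sub_apply, hA]
    ext <;> simp <;> ring
  have hDT : ∀ x, fderiv ℂ T 0 (A x) = fderiv ℂ T 0 x := by
    intro x
    have h1 : HasFDerivAt (T ∘ A) ((fderiv ℂ T 0).comp A) 0 := by
      have h2 : HasFDerivAt T (fderiv ℂ T 0) (A 0) := by
        rw [map_zero]; exact hT.differentiableAt.hasFDerivAt
      exact h2.comp 0 A.hasFDerivAt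
    have h3 := h1.unique (hT.differentiableAt.hasFDerivAt.congr_of_eventuallyEq hTA)
    exact congrArg (fun L => L x) h3
  have hDζ : ∀ x, fderiv ℂ ζ 0 (A x) = fderiv ℂ ζ 0 x + N * fderiv ℂ T 0 x := by
    intro x
    have h1 : HasFDerivAt (ζ ∘ A) ((fderiv ℂ ζ 0).comp A) 0 := by
      have h2 : HasFDerivAt ζ (fderiv ℂ ζ 0) (A 0) := by
        rw [map_zero]; exact hζ.differentiableAt.hasFDerivAt
      exact h2.comp 0 A.hasFDerivAt
    have h3 := h1.unique ((hζ.differentiableAt.hasFDerivAt.add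
      (hT.differentiableAt.hasFDerivAt.const_mul N)).congr_of_eventuallyEq hζA)
    simpa using congrArg (fun L => L x) h3
  have hn2 : ∀ w, n (n w) = 0 := by
    intro w
    have h1 : ∀ x, fderiv ℂ T 0 (n x) = 0 := fun x => by
      have := hDT x
      rw [hAn, map_add] at this
      linear_combination this
    have h2 : ∀ x, fderiv ℂ ζ 0 (n x) = N * fderiv ℂ T 0 x := fun x => by
      have := hDζ x
      rw [hAn, map_add] at this
      linear_combination this
    have h3 : fderiv ℂ ζ 0 (n (n w)) = 0 := by rw [h2, h1, mul_zero]
    have h4 := hdet.self_of_nhds (n (n w)) (1, 0)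
    have h5 := hdet.self_of_nhds (n (n w)) (0, 1)
    rw [h3, h1] at h4 h5
    simp only [zero_mul, mul_zero, sub_zero, mul_one, zero_sub] at h4 h5
    ext
    · simpa [hε] using h5
    · simpa [hε] using h4
  have htr : k + o = 2 := by
    have e1 := hn2 (1, 0)
    have e2 := hn2 (0, 1)
    simp only [hnw, Prod.mk_eq_zero] at e1 e2
    obtain ⟨e1, e3⟩ := e1
    obtain ⟨e2, e4⟩ := e2
    have f1 : (k + o - 2) * k = 0 := by linear_combination e1 + hA1
    have f2 : (k + o - 2) * l = 0 := by linear_combination e2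
    by_contra hne
    have hne' : k + o - 2 ≠ 0 := fun h => hne (by linear_combination h)
    have k0 := (mul_eq_zero.mp f1).resolve_left hne'
    have l0 := (mul_eq_zero.mp f2).resolve_left hne'
    rw [k0, l0] at hA1
    simp at hA1
  have F1 : ∀ᶠ w in 𝓝 0, fderiv ℂ T w (n w) = 0 := by
    have := fderiv_apply_nilpotent hT hT A n hAn hn2 0 (by simpa using hTA) hTA
    simpa using this
  have F2 : ∀ᶠ w in 𝓝 0, fderiv ℂ ζ w (n w) = N * T w :=
    fderiv_apply_nilpotent hζ hT A n hAn hn2 N hζA hTA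
  let b : ℂ × ℂ → ℂ × ℂ → ℂ := fun x y => x.1 * (n y).2 - x.2 * (n y).1
  have hkey : ∀ᶠ w in 𝓝 0, ∀ x, fderiv ℂ T w x * (N * T w) = ε * b x w := by
    filter_upwards [F1, F2, hdet] with w h1 h2 h3 x
    have := h3 x (n w)
    rw [h1, h2] at this
    linear_combination this
  -- The form b is symmetric because n has trace 0 (`htr`), so `hkey` says that N T² - ε b(w, w) has
  -- zero derivative; it vanishes at 0.
  have hsq : ∀ᶠ w in 𝓝 0, N * T w ^ 2 = ε * b w w := by
    obtain ⟨r, hr, hball⟩ := Metric.eventually_nhds_iff_ball.mp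
      (hkey.and hT.eventually_analyticAt)
    refine Metric.eventually_nhds_iff_ball.mpr ⟨r, hr, fun w hw => ?_⟩
    have hd : ∀ v ∈ Metric.ball (0 : ℂ × ℂ) r,
        HasFDerivAt (fun v => N * T v ^ 2 - ε * b v v) (0 : ℂ × ℂ →L[ℂ] ℂ) v := by
      intro v hv
      obtain ⟨h1, h2⟩ := hball v hv
      have g1 := ((h2.differentiableAt.hasFDerivAt.pow 2).const_mul N)
      have g2 : HasFDerivAt (fun v : ℂ × ℂ => ε * b v v)
          (ε • ((v.1 • (ContinuousLinearMap.snd ℂ ℂ ℂ).comp n +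
            (n v).2 • ContinuousLinearMap.fst ℂ ℂ ℂ) -
            (v.2 • (ContinuousLinearMap.fst ℂ ℂ ℂ).comp n +
            (n v).1 • ContinuousLinearMap.snd ℂ ℂ ℂ))) v := by
        refine HasFDerivAt.const_mul (HasFDerivAt.sub ?_ ?_) ε
        · exact (hasFDerivAt_fst (𝕜 := ℂ)).mul (((ContinuousLinearMap.snd ℂ ℂ ℂ).comp n).hasFDerivAt)
        · exact (hasFDerivAt_snd (𝕜 := ℂ)).mul (((ContinuousLinearMap.fst ℂ ℂ ℂ).comp n).hasFDerivAt)
      refine (g1.sub g2).congr_fderiv ?_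
      refine ContinuousLinearMap.ext fun x => ?_
      have h3 := h1 x
      simp only [b, hnw] at h3 ⊢
      simp [hnw]
      linear_combination 2 * h3 + ε * (v.2 * x.1 - v.1 * x.2) * htr
    have hc := Metric.isOpen_ball.is_const_of_fderiv_eq_zero
      (convex_ball (0 : ℂ × ℂ) r).isPreconnected
      (fun v hv => (hd v hv).differentiableAt.differentiableWithinAt)
      (fun v hv => (hd v hv).fderiv) hw (Metric.mem_ball_self hr)
    simp only [hT0, b, map_zero] at hc ⊢
    simp only [Prod.fst_zero, Prod.snd_zero] at hc
    linear_combination hc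
  -- This is det n = 0, which follows from trace n = 0 and det A = 1.
  have hbb : ∀ x w, b x x * b w w = b x w ^ 2 := by
    intro x w
    have ho : o = 2 - k := by linear_combination htr
    have hA2 := hA1
    simp only [b, hnw, ho] at hA2 ⊢
    linear_combination (x.1 * w.2 - x.2 * w.1) ^ 2 * hA2
  refine ⟨fun x => ε / N * b x x, ?_⟩
  have hne : ∀ᶠ w in 𝓝 0, T w ≠ 0 → ∀ x, fderiv ℂ T w x ^ 2 = ε / N * b x x := by
    filter_upwards [hkey, hsq] with w h1 h2 h0 x
    have h3 := h1 x
    have h4 := hbb x w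
    field_simp
    have h5 : (N * T w ^ 2) ≠ 0 := mul_ne_zero hN (pow_ne_zero 2 h0)
    apply mul_right_cancel₀ h5
    linear_combination (fderiv ℂ T w x * (N * T w) + ε * b x w) * h3 + ε * b x x * (-h2) - ε ^ 2 * h4
  filter_upwards [hne.eventually_nhds, hT.eventually_analyticAt, hdet] with w h1 h2 h3 x
  -- At a zero of T the factor T² cannot be cancelled. There dT ≠ 0 by the Jacobian condition, so T
  -- is non-zero at nearby points of a transversal line, and the formula passes to the limit.
  by_cases h0 : T w = 0
  · obtain ⟨v, hv⟩ : ∃ v, fderiv ℂ T w v ≠ 0 := by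
      by_contra! hv
      have := h3 (1, 0) (0, 1)
      simp [hv, hε.symm] at this
    have hline : HasDerivAt (fun s : ℂ => w + s • v) v 0 := by
      simpa using ((hasDerivAt_id (0 : ℂ)).smul_const v).const_add w
    have hw0 : w + (0 : ℂ) • v = w := by simp
    have hd : HasDerivAt (fun s : ℂ => T (w + s • v)) (fderiv ℂ T w v) 0 := by
      have hfd : HasFDerivAt T (fderiv ℂ T w) (w + (0 : ℂ) • v) := by
        rw [hw0]; exact h2.differentiableAt.hasFDerivAt
      exact hfd.comp_hasDerivAt (0 : ℂ) hline
    have hev := hd.eventually_ne (c := 0) hv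
    have htend : Filter.Tendsto (fun s : ℂ => w + s • v) (𝓝[≠] 0) (𝓝 w) := by
      have := hline.continuousAt.tendsto
      rw [hw0] at this
      exact this.mono_left nhdsWithin_le_nhds
    have hcont : Filter.Tendsto (fun s : ℂ => fderiv ℂ T (w + s • v) x ^ 2) (𝓝[≠] 0)
        (𝓝 (fderiv ℂ T w x ^ 2)) := by
      have h5 : ContinuousAt (fun u => fderiv ℂ T u x ^ 2) w :=
        (h2.fderiv.continuousAt.clm_apply continuousAt_const).pow 2
      exact h5.tendsto.comp htend
    refine tendsto_nhds_unique hcont (Filter.Tendsto.congr' ?_ tendsto_const_nhds)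
    filter_upwards [hev, htend.eventually h1] with s h6 h7
    exact (h7 h6 x).symm
  · exact h1.self_of_nhds h0 x

/-- If `(T, ζ)` are coordinates with constant Jacobian in which an affine map becomes the twist
`(T, ζ) ↦ (T, ζ + N T)`, then `(dT)²` is constant. -/
theorem exists_fderiv_sq_eq_of_twist {T ζ : ℂ × ℂ → ℂ} {q : ℂ × ℂ} (hT : AnalyticAt ℂ T q)
    (hζ : AnalyticAt ℂ ζ q) {ε N : ℂ} (hε : ε ≠ 0) (hN : N ≠ 0)
    (hdet : ∀ᶠ w in 𝓝 q, ∀ x y, fderiv ℂ T w x * fderiv ℂ ζ w y - fderiv ℂ T w y * fderiv ℂ ζ w x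
      = ε * (x.1 * y.2 - x.2 * y.1))
    {f : ℂ × ℂ → ℂ × ℂ} (hf : f ∈ Aff1) (hfq : f q = q)
    (hTf : ∀ᶠ w in 𝓝 q, T (f w) = T w) (hζf : ∀ᶠ w in 𝓝 q, ζ (f w) = ζ w + N * T w) :
    ∃ β : ℂ × ℂ → ℂ, ∀ᶠ w in 𝓝 q, ∀ x, fderiv ℂ T w x ^ 2 = β x := by
  obtain ⟨k, l, m, o, t, s, hA1, rfl⟩ := hf
  let A : ℂ × ℂ →L[ℂ] ℂ × ℂ :=
    (k • ContinuousLinearMap.fst ℂ ℂ ℂ + l • ContinuousLinearMap.snd ℂ ℂ ℂ).prod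
      (m • ContinuousLinearMap.fst ℂ ℂ ℂ + o • ContinuousLinearMap.snd ℂ ℂ ℂ)
  have hA : ∀ w, A w = (k * w.1 + l * w.2, m * w.1 + o * w.2) := fun w => by simp [A]
  have hfA : ∀ w : ℂ × ℂ, (k * (q + w).1 + l * (q + w).2 + t, m * (q + w).1 + o * (q + w).2 + s)
      = q + A w := by
    intro w
    rw [hA]
    have h1 := congrArg Prod.fst hfq
    have h2 := congrArg Prod.snd hfq
    simp only at h1 h2
    ext
    · simp only [Prod.fst_add, Prod.snd_add]; linear_combination h1
    · simp only [Prod.fst_add, Prod.snd_add]; linear_combination h2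
  have hadd : Filter.Tendsto (fun w : ℂ × ℂ => q + w) (𝓝 0) (𝓝 q) := by
    have : Continuous fun w : ℂ × ℂ => q + w := by fun_prop
    simpa using this.tendsto 0
  have hsub : Filter.Tendsto (fun w : ℂ × ℂ => w - q) (𝓝 q) (𝓝 0) := by
    have : Continuous fun w : ℂ × ℂ => w - q := by fun_prop
    simpa using this.tendsto q
  have han : ∀ g : ℂ × ℂ → ℂ, AnalyticAt ℂ g q → AnalyticAt ℂ (fun w => g (q + w)) 0 := by
    intro g hg
    have h1 : AnalyticAt ℂ g (q + 0) := by simpa using hg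
    exact AnalyticAt.comp (f := fun w : ℂ × ℂ => q + w) h1 (analyticAt_const.add analyticAt_id)
  obtain ⟨β, hβ⟩ := twist_linear (han T hT) (han ζ hζ) hε hN (by
    filter_upwards [hadd.eventually hdet] with w hw
    simpa only [fderiv_comp_add_left] using hw) A hA1 hA (by
    filter_upwards [hadd.eventually hTf] with w hw
    rw [← hfA, hw]) (by
    filter_upwards [hadd.eventually hζf] with w hw
    rw [← hfA, hw])
  refine ⟨β, ?_⟩
  filter_upwards [hsub.eventually hβ] with w hw
  simpa only [fderiv_comp_add_left, add_sub_cancel] using hw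

end Twist

/-! ### Differentials of the coordinates in a chart -/

section Charts

variable {a : Fin 4 → ℂ}

theorem fin3_add_one_add_one (i : Fin 3) : i + 1 + 1 = i + 2 := by revert i; decide

theorem fin3_add_one_add_two (i : Fin 3) : i + 1 + 2 = i := by revert i; decide

theorem fin3_add_two_add_one (i : Fin 3) : i + 2 + 1 = i := by revert i; decide

theorem fin3_add_two_add_two (i : Fin 3) : i + 2 + 2 = i + 1 := by revert i; decide

theorem cubic_eq (a : Fin 4 → ℂ) (x : Fin 3 → ℂ) (i : Fin 3) :
    cubic a x = x i ^ 2 + x (i + 1) ^ 2 + x (i + 2) ^ 2 + x i * x (i + 1) * x (i + 2) -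
      (a i.castSucc * x i + a (i + 1).castSucc * x (i + 1) + a (i + 2).castSucc * x (i + 2)
        + a 3) := by
  fin_cases i <;> simp [cubic] <;> ring

theorem eq_zero_of_grad {x : Fin 3 → ℂ} (i : Fin 3) (h0 : grad a x i = 0)
    (h1 : grad a x (i + 1) = 0) (h2 : grad a x (i + 2) = 0) : grad a x = 0 := by
  funext j
  fin_cases i <;> fin_cases j <;> simp_all

theorem mem_tangent_iff (x v : Fin 3 → ℂ) (i : Fin 3) : v ∈ tangent a x ↔
    grad a x i * v i + grad a x (i + 1) * v (i + 1) + grad a x (i + 2) * v (i + 2) = 0 := by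
  simp only [tangent, LinearMap.mem_ker, Fin.sum_univ_three, LinearMap.add_apply,
    LinearMap.smul_apply, LinearMap.proj_apply, smul_eq_mul]
  fin_cases i
  · simp
  · simp only [Fin.mk_one, Fin.isValue, Fin.reduceAdd]
    constructor <;> intro h <;> linear_combination h
  · simp only [Fin.reduceFinMk, Fin.isValue, Fin.reduceAdd]
    constructor <;> intro h <;> linear_combination h

/-- The coordinate `xᵢ` read in a chart. -/
noncomputable def HolChart.coord (c : HolChart a) (i : Fin 3) (q : ℂ × ℂ) : ℂ := c.param q i

theorem HolChart.cubic_param (c : HolChart a) (q : ℂ × ℂ) : cubic a (c.param q) = 0 :=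
  (c.toHomeo.symm q).2

theorem HolChart.differentiableAt_param (c : HolChart a) {q : ℂ × ℂ} (hq : q ∈ c.toHomeo.target) :
    DifferentiableAt ℂ c.param q :=
  c.holomorphic.differentiableAt (c.toHomeo.open_target.mem_nhds hq)

theorem HolChart.smooth_param (c : HolChart a) {q : ℂ × ℂ} (hq : q ∈ c.toHomeo.target) :
    grad a (c.param q) ≠ 0 :=
  c.smooth _ (c.toHomeo.map_target hq)

theorem HolChart.differentiableAt_coord (c : HolChart a) (i : Fin 3) {q : ℂ × ℂ}
    (hq : q ∈ c.toHomeo.target) : DifferentiableAt ℂ (c.coord i) q :=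
  differentiableAt_pi.mp (c.differentiableAt_param hq) i

theorem HolChart.analyticOnNhd_coord (c : HolChart a) (i : Fin 3) :
    AnalyticOnNhd ℂ (c.coord i) c.toHomeo.target :=
  analyticOnNhd_of_differentiableOn c.toHomeo.open_target
    fun _ hq => (c.differentiableAt_coord i hq).differentiableWithinAt

theorem HolChart.fderiv_param_apply (c : HolChart a) (i : Fin 3) {q : ℂ × ℂ}
    (hq : q ∈ c.toHomeo.target) (x : ℂ × ℂ) :
    fderiv ℂ c.param q x i = fderiv ℂ (c.coord i) q x := by
  have h := hasFDerivAt_pi'.mp (c.differentiableAt_param hq).hasFDerivAt i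
  have h2 : HasFDerivAt (c.coord i) ((ContinuousLinearMap.proj i).comp (fderiv ℂ c.param q)) q := h
  rw [h2.fderiv]
  rfl

theorem HolChart.fderiv_param_mem_tangent (c : HolChart a) {q : ℂ × ℂ}
    (hq : q ∈ c.toHomeo.target) (x : ℂ × ℂ) : fderiv ℂ c.param q x ∈ tangent a (c.param q) := by
  rw [mem_tangent_iff _ _ 0]
  simp only [c.fderiv_param_apply _ hq]
  have d0 := (c.differentiableAt_coord 0 hq).hasFDerivAt
  have d1 := (c.differentiableAt_coord 1 hq).hasFDerivAt
  have d2 := (c.differentiableAt_coord 2 hq).hasFDerivAt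
  have h := ((((d0.pow 2).add (d1.pow 2)).add (d2.pow 2)).add ((d0.mul d1).mul d2)).sub
    (((d0.const_mul (a 0)).add (d1.const_mul (a 1))).add (d2.const_mul (a 2)) |>.add_const (a 3))
  have h2 := h.unique ((hasFDerivAt_const (0 : ℂ) q).congr_of_eventuallyEq
    (Filter.Eventually.of_forall fun q => c.cubic_param q))
  have h3 := congrArg (fun L => L x) h2
  simp [HolChart.coord] at h3
  simp [grad] at h3 ⊢
  linear_combination h3

/-- In a symplectic chart, `dxⱼ ∧ dxₖ = Pᵢ du ∧ dv` for `(i, j, k)` in cyclic order. -/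
theorem HolChart.IsSymplectic.wedge {c : HolChart a} (hc : c.IsSymplectic) {q : ℂ × ℂ}
    (hq : q ∈ c.toHomeo.target) (i : Fin 3) (x y : ℂ × ℂ) :
    fderiv ℂ (c.coord (i + 1)) q x * fderiv ℂ (c.coord (i + 2)) q y -
      fderiv ℂ (c.coord (i + 2)) q x * fderiv ℂ (c.coord (i + 1)) q y =
      (x.1 * y.2 - x.2 * y.1) * grad a (c.param q) i := by
  have h := minor_eq_Omega_mul_grad a (c.param q) _ _ (c.smooth_param hq)
    (c.fderiv_param_mem_tangent hq (1, 0)) (c.fderiv_param_mem_tangent hq (0, 1)) i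
  rw [hc q hq, one_mul] at h
  simp only [c.fderiv_param_apply _ hq] at h
  have hx : ∀ (L : ℂ × ℂ →L[ℂ] ℂ) (x : ℂ × ℂ), L x = x.1 * L (1, 0) + x.2 * L (0, 1) := by
    intro L x
    have : x = x.1 • ((1, 0) : ℂ × ℂ) + x.2 • ((0, 1) : ℂ × ℂ) := by ext <;> simp
    conv_lhs => rw [this, map_add, map_smul, map_smul, smul_eq_mul, smul_eq_mul]
  rw [hx _ x, hx _ x, hx _ y, hx (fderiv ℂ (c.coord (i + 1)) q) y]
  linear_combination (x.1 * y.2 - x.2 * y.1) * h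

theorem HolChart.IsSymplectic.wedge' {c : HolChart a} (hc : c.IsSymplectic) {q : ℂ × ℂ}
    (hq : q ∈ c.toHomeo.target) (i : Fin 3) (x y : ℂ × ℂ) :
    fderiv ℂ (c.coord (i + 2)) q x * fderiv ℂ (c.coord i) q y -
      fderiv ℂ (c.coord i) q x * fderiv ℂ (c.coord (i + 2)) q y =
      (x.1 * y.2 - x.2 * y.1) * grad a (c.param q) (i + 1) := by
  have h := hc.wedge hq (i + 1) x y
  rwa [fin3_add_one_add_one, fin3_add_one_add_two] at h

theorem HolChart.IsSymplectic.wedge'' {c : HolChart a} (hc : c.IsSymplectic) {q : ℂ × ℂ}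
    (hq : q ∈ c.toHomeo.target) (i : Fin 3) (x y : ℂ × ℂ) :
    fderiv ℂ (c.coord i) q x * fderiv ℂ (c.coord (i + 1)) q y -
      fderiv ℂ (c.coord (i + 1)) q x * fderiv ℂ (c.coord i) q y =
      (x.1 * y.2 - x.2 * y.1) * grad a (c.param q) (i + 2) := by
  have h := hc.wedge hq (i + 2) x y
  rwa [fin3_add_two_add_one, fin3_add_two_add_two] at h

/-- None of the partial derivatives of the cubic vanishes on an open subset of the surface. -/
theorem HolChart.IsSymplectic.exists_grad_ne_zero {c : HolChart a} (hc : c.IsSymplectic)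
    {V : Set (ℂ × ℂ)} (hV : IsOpen V) (hVt : V ⊆ c.toHomeo.target) (hne : V.Nonempty)
    (i : Fin 3) : ∃ q ∈ V, grad a (c.param q) i ≠ 0 := by
  by_contra! h
  obtain ⟨q, hq⟩ := hne
  have d0 := (c.differentiableAt_coord i (hVt hq)).hasFDerivAt
  have d1 := (c.differentiableAt_coord (i + 1) (hVt hq)).hasFDerivAt
  have d2 := (c.differentiableAt_coord (i + 2) (hVt hq)).hasFDerivAt
  -- If Pᵢ = 2xᵢ + xⱼxₖ - aᵢ vanishes on an open set, so does its differential. Wedging this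
  -- relation with dxⱼ and dxₖ, where dxⱼ ∧ dxₖ = 0, makes the other two partial derivatives vanish
  -- as well, against smoothness.
  have hd := ((d0.const_mul 2).add (d1.mul d2)).sub_const (a i.castSucc)
  have hu := hd.unique ((hasFDerivAt_const (0 : ℂ) q).congr_of_eventuallyEq (by
    filter_upwards [hV.mem_nhds hq] with q' hq'
    exact h q' hq'))
  have hx : ∀ x, 2 * fderiv ℂ (c.coord i) q x + (c.coord (i + 1) q * fderiv ℂ (c.coord (i + 2)) q x
      + c.coord (i + 2) q * fderiv ℂ (c.coord (i + 1)) q x) = 0 := fun x => by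
    simpa using congrArg (fun L => L x) hu
  have w0 := hc.wedge (hVt hq) i (1, 0) (0, 1)
  have w1 := hc.wedge' (hVt hq) i (1, 0) (0, 1)
  have w2 := hc.wedge'' (hVt hq) i (1, 0) (0, 1)
  have e1 := hx (1, 0)
  have e2 := hx (0, 1)
  rw [h q hq] at w0
  simp only [mul_one, mul_zero, sub_zero, one_mul] at w0 w1 w2
  refine c.smooth_param (hVt hq) (eq_zero_of_grad i (h q hq) ?_ ?_)
  · rw [← w1]
    linear_combination (1 / 2 : ℂ) * (fderiv ℂ (c.coord (i + 2)) q (1, 0) * e2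
      - fderiv ℂ (c.coord (i + 2)) q (0, 1) * e1 + c.coord (i + 2) q * w0)
  · rw [← w2]
    linear_combination (1 / 2 : ℂ) * (fderiv ℂ (c.coord (i + 1)) q (0, 1) * e1
      - fderiv ℂ (c.coord (i + 1)) q (1, 0) * e2 + c.coord (i + 1) q * w0)

/-- If `dxᵢ` is a non-zero multiple of `l`, then `ℱᵢ` is sent by the chart to `ker l`. -/
theorem HolChart.comap_foliation_eq (c : HolChart a) {q : ℂ × ℂ} (hq : q ∈ c.toHomeo.target)
    (i : Fin 3) {l : ℂ × ℂ →ₗ[ℂ] ℂ} {r : ℂ} (hr : r ≠ 0)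
    (h : ∀ x, fderiv ℂ (c.coord i) q x = r * l x) :
    (foliation a i (c.param q)).comap (fderiv ℂ c.param q : ℂ × ℂ →ₗ[ℂ] (Fin 3 → ℂ))
      = LinearMap.ker l := by
  ext x
  have h1 := c.fderiv_param_mem_tangent hq x
  have h2 := c.fderiv_param_apply i hq x
  simp [foliation, h1, h2, h, hr]

/-- When dxᵢ vanishes at a point, the wedge formulas kill the two other partial derivatives, so the
tangent plane is the kernel of the i-th coordinate. -/
theorem HolChart.IsSymplectic.foliation_eq_tangent {c : HolChart a} (hc : c.IsSymplectic)
    {q : ℂ × ℂ} (hq : q ∈ c.toHomeo.target) (i : Fin 3)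
    (h : ∀ x, fderiv ℂ (c.coord i) q x = 0) :
    foliation a i (c.param q) = tangent a (c.param q) := by
  have w1 := hc.wedge' hq i (1, 0) (0, 1)
  have w2 := hc.wedge'' hq i (1, 0) (0, 1)
  simp only [h, mul_zero, zero_mul, sub_zero, mul_one, one_mul] at w1 w2
  have h0 : grad a (c.param q) i ≠ 0 := fun h0 =>
    c.smooth_param hq (eq_zero_of_grad i h0 w1.symm w2.symm)
  refine inf_eq_left.mpr fun v hv => ?_
  rw [mem_tangent_iff _ _ i, ← w1, ← w2] at hv
  simpa [h0] using hv

theorem HolChart.IsSymplectic.exists_sq_ne_four {c : HolChart a} (hc : c.IsSymplectic)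
    {V : Set (ℂ × ℂ)} (hV : IsOpen V) (hVt : V ⊆ c.toHomeo.target) (hne : V.Nonempty)
    (i : Fin 3) : ∃ q ∈ V, c.coord i q ^ 2 - 4 ≠ 0 := by
  by_contra! h
  -- If xᵢ² = 4 on V, then dxᵢ = 0 there, and the wedge formula would give zero for the partial
  -- derivative that is non-zero at q.
  obtain ⟨q, hq, hg⟩ := hc.exists_grad_ne_zero hV hVt hne (i + 1)
  have d0 := (c.differentiableAt_coord i (hVt hq)).hasFDerivAt
  have hu := ((d0.pow 2).sub_const 4).unique
    ((hasFDerivAt_const (0 : ℂ) q).congr_of_eventuallyEq (by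
      filter_upwards [hV.mem_nhds hq] with q' hq'
      exact h q' hq'))
  have h0 : c.coord i q ≠ 0 := fun h0 => by
    have := h q hq
    rw [h0] at this
    norm_num at this
  have hx : ∀ x, fderiv ℂ (c.coord i) q x = 0 := fun x => by
    simpa [h0] using congrArg (fun L => L x) hu
  have w1 := hc.wedge' (hVt hq) i (1, 0) (0, 1)
  simp only [hx, mul_zero, zero_mul, sub_zero, mul_one, one_mul] at w1
  exact hg w1.symm

end Charts

/-! ### The conic fibration `xᵢ : S_a → ℂ` -/

section Conics

/-- The vector with `i`-th coordinate `c` and next coordinates `x`, `y`, in cyclic order. -/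
def cyclicVec (i : Fin 3) (c x y : ℂ) : Fin 3 → ℂ :=
  fun j => if j = i then c else if j = i + 1 then x else y

@[simp] theorem cyclicVec_self (i : Fin 3) (c x y : ℂ) : cyclicVec i c x y i = c := by
  simp [cyclicVec]

@[simp] theorem cyclicVec_add_one (i : Fin 3) (c x y : ℂ) : cyclicVec i c x y (i + 1) = x := by
  fin_cases i <;> simp [cyclicVec]

@[simp] theorem cyclicVec_add_two (i : Fin 3) (c x y : ℂ) : cyclicVec i c x y (i + 2) = y := by
  fin_cases i <;> simp [cyclicVec]

theorem ext_cyclic {α : Type*} (i : Fin 3) {x y : Fin 3 → α} (h0 : x i = y i)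
    (h1 : x (i + 1) = y (i + 1)) (h2 : x (i + 2) = y (i + 2)) : x = y := by
  funext j
  fin_cases i <;> fin_cases j <;> simp_all

variable (a : Fin 4 → ℂ) (i : Fin 3)

/-- In the coordinates `X = xⱼ + t xₖ`, `Y = xⱼ + t⁻¹ xₖ`, the conic `xᵢ = t + t⁻¹` has the
equation `(X - conicCenter₁) (Y - conicCenter₂) = conicConst`. -/
noncomputable def conicCenter₁ (t : ℂ) : ℂ :=
  t * (a (i + 1).castSucc * t - a (i + 2).castSucc) * (t ^ 2 - 1)⁻¹

/-- The second coordinate of the center of the conic `xᵢ = t + t⁻¹`. -/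
noncomputable def conicCenter₂ (t : ℂ) : ℂ :=
  (a (i + 2).castSucc * t - a (i + 1).castSucc) * (t ^ 2 - 1)⁻¹

/-- The constant in the equation of the conic `xᵢ = t + t⁻¹`. -/
noncomputable def conicConst (t : ℂ) : ℂ :=
  conicCenter₁ a i t * conicCenter₂ a i t - (t + t⁻¹) ^ 2 + a i.castSucc * (t + t⁻¹) + a 3

/-- The parameter of a point of the conic `xᵢ = t + t⁻¹`. -/
noncomputable def conicParam (t : ℂ) (x : Fin 3 → ℂ) : ℂ :=
  x (i + 1) + t * x (i + 2) - conicCenter₁ a i t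

/-- The point of the conic `xᵢ = t + t⁻¹` with parameter `z`. -/
noncomputable def conicPt (t z : ℂ) : Fin 3 → ℂ :=
  let X := conicCenter₁ a i t + z
  let Y := conicCenter₂ a i t + conicConst a i t * z⁻¹
  let y := (X - Y) * t * (t ^ 2 - 1)⁻¹
  cyclicVec i (t + t⁻¹) (X - t * y) y

variable {a i}

/-- For xᵢ = t + t⁻¹ the quadratic part in the other two variables is (xⱼ + t xₖ)(xⱼ + t⁻¹xₖ). The
two factors are independent because t² ≠ 1, so a translation by the centers absorbs the linear
terms. -/
theorem cubic_eq_conic {t : ℂ} (ht : t ≠ 0) (ht1 : t ^ 2 - 1 ≠ 0) {x : Fin 3 → ℂ}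
    (hx : x i = t + t⁻¹) : cubic a x = conicParam a i t x *
      (x (i + 1) + t⁻¹ * x (i + 2) - conicCenter₂ a i t) - conicConst a i t := by
  rw [cubic_eq a x i, hx, conicParam, conicConst, conicCenter₁, conicCenter₂]
  field_simp
  ring

theorem conicPt_mem {t z : ℂ} (ht : t ≠ 0) (ht1 : t ^ 2 - 1 ≠ 0) (hz : z ≠ 0) :
    conicPt a i t z ∈ surface a := by
  have h : (conicPt a i t z) i = t + t⁻¹ := by simp [conicPt]
  change cubic a _ = 0
  rw [cubic_eq_conic ht ht1 h, conicParam]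
  simp only [conicPt, cyclicVec_add_one, cyclicVec_add_two]
  field_simp
  ring

theorem conicParam_conicPt (t z : ℂ) : conicParam a i t (conicPt a i t z) = z := by
  simp only [conicPt, conicParam, cyclicVec_add_one, cyclicVec_add_two]
  ring

theorem eq_conicPt {t : ℂ} (ht : t ≠ 0) (ht1 : t ^ 2 - 1 ≠ 0) {x : Fin 3 → ℂ}
    (hx : x i = t + t⁻¹) (hxs : x ∈ surface a) (hz : conicParam a i t x ≠ 0) :
    x = conicPt a i t (conicParam a i t x) := by
  have h : cubic a x = 0 := hxs
  rw [cubic_eq_conic ht ht1 hx] at h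
  have hY : conicCenter₂ a i t + conicConst a i t * (conicParam a i t x)⁻¹
      = x (i + 1) + t⁻¹ * x (i + 2) := by
    field_simp
    field_simp at h
    linear_combination -h
  have hX : conicCenter₁ a i t + conicParam a i t x = x (i + 1) + t * x (i + 2) := by
    rw [conicParam]; ring
  have hy : (x (i + 1) + t * x (i + 2) - (x (i + 1) + t⁻¹ * x (i + 2))) * t * (t ^ 2 - 1)⁻¹
      = x (i + 2) := by
    field_simp
    ring
  refine ext_cyclic i ?_ ?_ ?_
  · simp [conicPt, hx]
  · simp only [conicPt, cyclicVec_add_one, hX, hY, hy]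
    ring
  · simp only [conicPt, cyclicVec_add_two, hX, hY, hy]

/-- The combination `P_{i+2} - t P_{i+1}` of partial derivatives on the conic `xᵢ = t + t⁻¹`. -/
theorem grad_sub_grad {t : ℂ} (ht : t ≠ 0) (ht1 : t ^ 2 - 1 ≠ 0) {x : Fin 3 → ℂ}
    (hx : x i = t + t⁻¹) : grad a x (i + 2) - t * grad a x (i + 1) =
      -(t - t⁻¹) * conicParam a i t x := by
  rw [grad, grad, fin3_add_two_add_one, fin3_add_two_add_two, fin3_add_one_add_one,
    fin3_add_one_add_two, hx, conicParam, conicCenter₁]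
  field_simp
  ring

theorem sub_inv_ne_zero {t : ℂ} (ht : t ≠ 0) (ht1 : t ^ 2 - 1 ≠ 0) : t - t⁻¹ ≠ 0 := by
  intro h
  apply ht1
  field_simp at h
  linear_combination h

theorem grad_conicPt_ne_zero {t z : ℂ} (ht : t ≠ 0) (ht1 : t ^ 2 - 1 ≠ 0) (hz : z ≠ 0) :
    grad a (conicPt a i t z) ≠ 0 := by
  intro h
  have h1 := grad_sub_grad (a := a) (i := i) ht ht1 (x := conicPt a i t z) (by simp [conicPt])
  rw [h, conicParam_conicPt] at h1
  simp only [Pi.zero_apply, mul_zero, sub_zero] at h1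
  exact mul_ne_zero (neg_ne_zero.mpr (sub_inv_ne_zero ht ht1)) hz h1.symm

/-- The product `σⱼ ∘ σₖ` multiplies the parameter of the conic `xᵢ = t + t⁻¹` by `t⁻²`. -/
theorem conicParam_sigma {t : ℂ} (ht : t ≠ 0) (ht1 : t ^ 2 - 1 ≠ 0) {p : surface a}
    (hp : (p : Fin 3 → ℂ) i = t + t⁻¹) :
    ((sigma a (i + 1) * sigma a (i + 2)) p : Fin 3 → ℂ) i = t + t⁻¹ ∧
    conicParam a i t ((sigma a (i + 1) * sigma a (i + 2)) p) =
      (t ^ 2)⁻¹ * conicParam a i t p := by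
  have e1 : ((sigma a (i + 1) * sigma a (i + 2)) p : Fin 3 → ℂ) =
    sigmaFun a (i + 1) (sigmaFun a (i + 2) p) := rfl
  have n1 : i ≠ i + 1 := by clear * -; revert i; decide
  have n2 : i ≠ i + 2 := by clear * -; revert i; decide
  have n3 : i + 1 ≠ i + 2 := by clear * -; revert i; decide
  rw [e1, conicParam, conicParam, conicCenter₁]
  simp only [sigmaFun, fin3_add_two_add_one, fin3_add_two_add_two, fin3_add_one_add_one,
    fin3_add_one_add_two, Function.update_self, Function.update_of_ne n1, Function.update_of_ne n2,
    Function.update_of_ne n3, Function.update_of_ne n3.symm, hp, true_and]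
  field_simp
  ring

theorem conicParam_sigma_pow {t : ℂ} (ht : t ≠ 0) (ht1 : t ^ 2 - 1 ≠ 0) {p : surface a}
    (hp : (p : Fin 3 → ℂ) i = t + t⁻¹) (m : ℕ) :
    (((sigma a (i + 1) * sigma a (i + 2)) ^ m) p : Fin 3 → ℂ) i = t + t⁻¹ ∧
    conicParam a i t (((sigma a (i + 1) * sigma a (i + 2)) ^ m) p) =
      ((t ^ 2)⁻¹) ^ m * conicParam a i t p := by
  induction m with
  | zero => simp [hp]
  | succ m ih =>
    rw [pow_succ', Equiv.Perm.mul_apply]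
    have h := conicParam_sigma ht ht1 ih.1
    exact ⟨h.1, by rw [h.2, ih.2]; ring⟩

theorem sigma_mul_sigma_mem (a : Fin 4 → ℂ) (i : Fin 3) :
    sigma a (i + 1) * sigma a (i + 2) ∈ Gamma2 a := by
  have h01 : sigma a 0 * sigma a 1 ∈ Gamma2 a := Subgroup.subset_closure (by simp)
  have h12 : sigma a 1 * sigma a 2 ∈ Gamma2 a := Subgroup.subset_closure (by simp)
  have hs : ∀ j, sigma a j * sigma a j = 1 := fun j =>
    Equiv.ext fun p => (sigma a j).left_inv p
  fin_cases i
  · exact h12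
  · have h := inv_mem (mul_mem h01 h12)
    -- Only two of the three cyclic products are generators of `Gamma2`; the third is the inverse of
    -- their product.
    have e : (sigma a 0 * sigma a 1 * (sigma a 1 * sigma a 2))⁻¹ = sigma a 2 * sigma a 0 := by
      rw [inv_eq_iff_mul_eq_one]
      calc sigma a 0 * sigma a 1 * (sigma a 1 * sigma a 2) * (sigma a 2 * sigma a 0)
          = sigma a 0 * (sigma a 1 * sigma a 1) * (sigma a 2 * sigma a 2) * sigma a 0 := by group
        _ = 1 := by rw [hs, hs, mul_one, mul_one, hs]
    rw [e] at h
    exact h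
  · exact h01

theorem continuous_sigma (a : Fin 4 → ℂ) (j : Fin 3) : Continuous (sigma a j) := by
  refine Continuous.subtype_mk ?_ _
  have h : ∀ k, Continuous fun x : surface a => (x : Fin 3 → ℂ) k := fun k =>
    (continuous_apply k).comp continuous_subtype_val
  exact continuous_subtype_val.update j ((continuous_const.sub (h j)).sub ((h _).mul (h _)))

theorem continuous_sigma_pow (a : Fin 4 → ℂ) (i j : Fin 3) (m : ℕ) :
    Continuous ((sigma a i * sigma a j) ^ m) := by
  induction m with
  | zero => exact continuous_id
  | succ m ih =>
    rw [pow_succ, Equiv.Perm.coe_mul, Equiv.Perm.coe_mul]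
    exact ih.comp ((continuous_sigma a i).comp (continuous_sigma a j))

theorem exists_add_inv_eq (c : ℂ) : ∃ t : ℂ, t ≠ 0 ∧ c = t + t⁻¹ := by
  obtain ⟨s, hs⟩ := IsAlgClosed.exists_pow_nat_eq (c ^ 2 - 4) (n := 2) (by norm_num)
  have h : ((c + s) / 2) * ((c - s) / 2) = 1 := by linear_combination -hs / 4
  have h0 : (c + s) / 2 ≠ 0 := left_ne_zero_of_mul_eq_one h
  refine ⟨(c + s) / 2, h0, ?_⟩
  rw [← eq_inv_of_mul_eq_one_right h]
  ring

end Conics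

/-! ### Generic points and connectedness -/

section Generic

/-- `φ` is a rational function whose denominator is a power of `δ`. -/
def IsRegularOff (δ : Polynomial ℂ) (φ : ℂ → ℂ) : Prop :=
  ∃ (n : ℕ) (P : Polynomial ℂ), ∀ s, δ.eval s ≠ 0 → φ s * δ.eval s ^ n = P.eval s

namespace IsRegularOff

variable {δ : Polynomial ℂ} {φ ψ : ℂ → ℂ}

theorem of_polynomial (P : Polynomial ℂ) : IsRegularOff δ fun s => P.eval s :=
  ⟨0, P, fun s _ => by simp⟩

theorem const (k : ℂ) : IsRegularOff δ fun _ => k := by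
  simpa using of_polynomial (δ := δ) (Polynomial.C k)

theorem add (hφ : IsRegularOff δ φ) (hψ : IsRegularOff δ ψ) :
    IsRegularOff δ fun s => φ s + ψ s := by
  obtain ⟨n, P, hP⟩ := hφ
  obtain ⟨m, R, hR⟩ := hψ
  refine ⟨n + m, P * δ ^ m + R * δ ^ n, fun s hs => ?_⟩
  simp only [Polynomial.eval_add, Polynomial.eval_mul, Polynomial.eval_pow, ← hP s hs, ← hR s hs]
  ring

theorem mul (hφ : IsRegularOff δ φ) (hψ : IsRegularOff δ ψ) :
    IsRegularOff δ fun s => φ s * ψ s := by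
  obtain ⟨n, P, hP⟩ := hφ
  obtain ⟨m, R, hR⟩ := hψ
  refine ⟨n + m, P * R, fun s hs => ?_⟩
  simp only [Polynomial.eval_mul, ← hP s hs, ← hR s hs]
  ring

theorem sub (hφ : IsRegularOff δ φ) (hψ : IsRegularOff δ ψ) :
    IsRegularOff δ fun s => φ s - ψ s := by
  simpa [sub_eq_add_neg] using hφ.add ((const (-1)).mul hψ)

theorem inv {e : Polynomial ℂ} (he : e ∣ δ) : IsRegularOff δ fun s => (e.eval s)⁻¹ := by
  obtain ⟨e', rfl⟩ := he
  refine ⟨1, e', fun s hs => ?_⟩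
  rw [Polynomial.eval_mul] at hs ⊢
  have h := left_ne_zero_of_mul hs
  field_simp

theorem mvPolynomial_eval {r : Fin 3 → ℂ → ℂ} (hr : ∀ j, IsRegularOff δ (r j))
    (f : MvPolynomial (Fin 3) ℂ) :
    IsRegularOff δ fun s => MvPolynomial.eval (fun j => r j s) f := by
  induction f using MvPolynomial.induction_on with
  | C k => simpa using const k
  | add p q hp hq => simpa using hp.add hq
  | mul_X p j hp => simpa using hp.mul (hr j)

theorem finite_zeros (hφ : IsRegularOff δ φ) {s₀ : ℂ} (h0 : δ.eval s₀ ≠ 0) (h1 : φ s₀ ≠ 0) :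
    {s | δ.eval s = 0 ∨ φ s = 0}.Finite := by
  obtain ⟨n, P, hP⟩ := hφ
  have hP0 : P * δ ≠ 0 := by
    intro h
    have h2 := congrArg (Polynomial.eval s₀) h
    rw [Polynomial.eval_mul, ← hP s₀ h0, Polynomial.eval_zero] at h2
    exact mul_ne_zero (mul_ne_zero h1 (pow_ne_zero n h0)) h0 h2
  refine (Polynomial.finite_setOfPred_isRoot hP0).subset fun s hs => ?_
  rw [Set.mem_ofPred_eq, Polynomial.IsRoot, Polynomial.eval_mul]
  by_cases hd : δ.eval s = 0
  · rw [hd, mul_zero]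
  · rw [← hP s hd, hs.resolve_left hd, zero_mul, zero_mul]

end IsRegularOff

/-- The parameters `(t, z)` of generic points of the surface at which `f` does not vanish. -/
def GenericParam (a : Fin 4 → ℂ) (i : Fin 3) (f : MvPolynomial (Fin 3) ℂ) (t z : ℂ) : Prop :=
  t ≠ 0 ∧ t ^ 2 - 1 ≠ 0 ∧ z ≠ 0 ∧ MvPolynomial.eval (conicPt a i t z) f ≠ 0

variable {a : Fin 4 → ℂ} {i : Fin 3} {f : MvPolynomial (Fin 3) ℂ}

/-- Along a complex line of parameters, the coordinates of `conicPt`, and hence the value of f, are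
rational functions of s with denominator a power of δ. The non-generic parameters are zeros of a
polynomial that does not vanish at s = 0. -/
theorem GenericParam.finite_not {t z : ℂ} (h : GenericParam a i f t z) (t' z' : ℂ) :
    {s : ℂ | ¬ GenericParam a i f (t + s * t') (z + s * z')}.Finite := by
  let T : Polynomial ℂ := Polynomial.C t + Polynomial.X * Polynomial.C t'
  let Z : Polynomial ℂ := Polynomial.C z + Polynomial.X * Polynomial.C z'
  have hT : ∀ s, T.eval s = t + s * t' := fun s => by
    rw [Polynomial.eval_add, Polynomial.eval_mul, Polynomial.eval_C, Polynomial.eval_C,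
      Polynomial.eval_X]
  have hZ : ∀ s, Z.eval s = z + s * z' := fun s => by
    rw [Polynomial.eval_add, Polynomial.eval_mul, Polynomial.eval_C, Polynomial.eval_C,
      Polynomial.eval_X]
  let δ : Polynomial ℂ := T * (T ^ 2 - 1) * Z
  have hδ : ∀ s, δ.eval s = (t + s * t') * ((t + s * t') ^ 2 - 1) * (z + s * z') := fun s => by
    simp only [δ, Polynomial.eval_mul, Polynomial.eval_sub, Polynomial.eval_pow,
      Polynomial.eval_one, hT, hZ]
  have rT : IsRegularOff δ fun s => t + s * t' := by
    simpa only [hT] using IsRegularOff.of_polynomial (δ := δ) T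
  have rZ : IsRegularOff δ fun s => z + s * z' := by
    simpa only [hZ] using IsRegularOff.of_polynomial (δ := δ) Z
  have rTi : IsRegularOff δ fun s => (t + s * t')⁻¹ := by
    simpa only [hT] using IsRegularOff.inv (δ := δ) (e := T) ⟨(T ^ 2 - 1) * Z, by ring⟩
  have rZi : IsRegularOff δ fun s => (z + s * z')⁻¹ := by
    simpa only [hZ] using IsRegularOff.inv (δ := δ) (e := Z) ⟨T * (T ^ 2 - 1), by ring⟩
  have rDi : IsRegularOff δ fun s => ((t + s * t') ^ 2 - 1)⁻¹ := by
    have hdvd : T ^ 2 - 1 ∣ δ := ⟨T * Z, by ring⟩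
    have hD : ∀ s, (T ^ 2 - 1).eval s = (t + s * t') ^ 2 - 1 := fun s => by
      rw [Polynomial.eval_sub, Polynomial.eval_pow, Polynomial.eval_one, hT]
    have h := IsRegularOff.inv hdvd
    simp only [hD] at h
    exact h
  have r1 : IsRegularOff δ fun s => conicCenter₁ a i (t + s * t') :=
    (rT.mul (((IsRegularOff.const _).mul rT).sub (IsRegularOff.const _))).mul rDi
  have r2 : IsRegularOff δ fun s => conicCenter₂ a i (t + s * t') :=
    (((IsRegularOff.const _).mul rT).sub (IsRegularOff.const _)).mul rDi
  have rc := rT.add rTi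
  have r3 : IsRegularOff δ fun s => conicConst a i (t + s * t') := by
    have := (((r1.mul r2).sub (rc.mul rc)).add ((IsRegularOff.const (a i.castSucc)).mul rc)).add
      (IsRegularOff.const (a 3))
    simpa only [conicConst, sq] using this
  have rX := r1.add rZ
  have rY := r2.add (r3.mul rZi)
  have ry := ((rX.sub rY).mul rT).mul rDi
  have rx := rX.sub (rT.mul ry)
  have rP : ∀ j, IsRegularOff δ fun s => conicPt a i (t + s * t') (z + s * z') j := by
    intro j
    simp only [conicPt, cyclicVec]
    split_ifs
    · exact rc
    · exact rx
    · exact ry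
  have hfin := (IsRegularOff.mvPolynomial_eval rP f).finite_zeros (s₀ := 0)
    (by rw [hδ]; simpa using ⟨⟨h.1, h.2.1⟩, h.2.2.1⟩) (by simpa using h.2.2.2)
  refine hfin.subset fun s hs => ?_
  by_contra hcon
  rw [Set.mem_ofPred_eq, not_or, hδ] at hcon
  exact hs ⟨left_ne_zero_of_mul (left_ne_zero_of_mul hcon.1),
    right_ne_zero_of_mul (left_ne_zero_of_mul hcon.1), right_ne_zero_of_mul hcon.1, hcon.2⟩

theorem continuousAt_conicPt_line {t z t' z' s : ℂ} (h1 : t + s * t' ≠ 0)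
    (h2 : (t + s * t') ^ 2 - 1 ≠ 0) (h3 : z + s * z' ≠ 0) :
    ContinuousAt (fun s => conicPt a i (t + s * t') (z + s * z')) s := by
  refine continuousAt_pi.mpr fun j => ?_
  simp only [conicPt, cyclicVec, conicConst, conicCenter₁, conicCenter₂]
  split_ifs <;> fun_prop (disch := assumption)

/-- The set of generic points of the surface at which `f` does not vanish. -/
def genericSet (a : Fin 4 → ℂ) (i : Fin 3) (f : MvPolynomial (Fin 3) ℂ) : Set (Fin 3 → ℂ) :=
  {x | ∃ t z, GenericParam a i f t z ∧ x = conicPt a i t z}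

/-- Two generic parameters lie on a complex line with only finitely many non-generic points. The
plane ℂ minus a finite set is connected, and so is its image on the surface. -/
theorem isPreconnected_genericSet (a : Fin 4 → ℂ) (i : Fin 3) (f : MvPolynomial (Fin 3) ℂ) :
    IsPreconnected (genericSet a i f) := by
  refine isPreconnected_of_forall_pair ?_
  rintro _ ⟨t₁, z₁, h₁, rfl⟩ _ ⟨t₂, z₂, h₂, rfl⟩
  let B : Set ℂ := {s | ¬ GenericParam a i f (t₁ + s * (t₂ - t₁)) (z₁ + s * (z₂ - z₁))}
  have hB : B.Countable := (h₁.finite_not (t₂ - t₁) (z₂ - z₁)).countable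
  have hconn : IsPreconnected Bᶜ :=
    (hB.isConnected_compl_of_one_lt_rank (by simp)).isPreconnected
  have hmem : ∀ s ∈ Bᶜ, GenericParam a i f (t₁ + s * (t₂ - t₁)) (z₁ + s * (z₂ - z₁)) :=
    fun s hs => not_not.mp hs
  refine ⟨(fun s => conicPt a i (t₁ + s * (t₂ - t₁)) (z₁ + s * (z₂ - z₁))) '' Bᶜ, ?_, ?_, ?_, ?_⟩
  · rintro _ ⟨s, hs, rfl⟩
    exact ⟨_, _, hmem s hs, rfl⟩
  · exact ⟨0, by simpa [B] using h₁, by simp⟩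
  · exact ⟨1, by simpa [B] using h₂, by simp⟩
  · refine hconn.image _ fun s hs => ContinuousAt.continuousWithinAt ?_
    have h := hmem s hs
    exact continuousAt_conicPt_line h.1 h.2.1 h.2.2.1

/-- The values of `xᵢ` with a singular fibre are finite in number. -/
theorem finite_bad_values (a : Fin 4 → ℂ) (i : Fin 3) :
    {c : ℂ | ∃ t, t ≠ 0 ∧ c = t + t⁻¹ ∧ (t ^ 2 - 1 = 0 ∨ conicConst a i t = 0)}.Finite := by
  let b := a (i + 1).castSucc
  let d := a (i + 2).castSucc
  -- K is t² (t² - 1)² times `conicConst`. Its value at t = 0 is -1, so it is not the zero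
  -- polynomial whatever the parameters are.
  let K : Polynomial ℂ := .X ^ 3 * (.C d * .X - .C b) * (.C b * .X - .C d)
    - (.X ^ 2 + 1) ^ 2 * (.X ^ 2 - 1) ^ 2 + .C (a i.castSucc) * .X * (.X ^ 2 + 1) * (.X ^ 2 - 1) ^ 2
    + .C (a 3) * .X ^ 2 * (.X ^ 2 - 1) ^ 2
  let D : Polynomial ℂ := .X ^ 2 - 1
  have hKD : K * D ≠ 0 := by
    intro h
    have := congrArg (Polynomial.eval 0) h
    simp [K, D] at this
  have hK : ∀ t, t ≠ 0 → t ^ 2 - 1 ≠ 0 → K.eval t = t ^ 2 * (t ^ 2 - 1) ^ 2 * conicConst a i t := by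
    intro t h1 h2
    simp [K, conicConst, conicCenter₁, conicCenter₂]
    field_simp
    ring
  refine ((Polynomial.finite_setOfPred_isRoot hKD).image fun t => t + t⁻¹).subset ?_
  rintro _ ⟨t, h1, rfl, h2⟩
  refine ⟨t, ?_, rfl⟩
  rw [Set.mem_ofPred_eq, Polynomial.IsRoot, Polynomial.eval_mul]
  by_cases h3 : t ^ 2 - 1 = 0
  · have : D.eval t = 0 := by simpa [D] using h3
    rw [this, mul_zero]
  · rw [hK t h1 h3, h2.resolve_left h3, mul_zero, zero_mul]

theorem eventually_nhdsNE_notMem_of_finite {B : Set ℂ} (hB : B.Finite) (x : ℂ) :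
    ∀ᶠ s in 𝓝[≠] x, s ∉ B := by
  have h : (B \ {x})ᶜ ∈ 𝓝 x := hB.sdiff.isClosed.isOpen_compl.mem_nhds (by simp)
  filter_upwards [mem_nhdsWithin_of_mem_nhds h, self_mem_nhdsWithin] with s h1 h2 h3
  exact h1 ⟨h3, h2⟩

/-- Points of the surface can be moved to points with any nearby value of `xᵢ`. -/
theorem eventually_exists_near {x : Fin 3 → ℂ} (hx : x ∈ surface a) (i : Fin 3) {ε : ℝ}
    (hε : 0 < ε) : ∀ᶠ c in 𝓝 (x i), ∃ y ∈ surface a, y i = c ∧ dist y x < ε := by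
  let F : ℂ → ℂ := fun c => cubic a (cyclicVec i c (x (i + 1)) (x (i + 2)))
  have hF : ∀ c, F c = c ^ 2 + x (i + 1) ^ 2 + x (i + 2) ^ 2 + c * x (i + 1) * x (i + 2) -
      (a i.castSucc * c + a (i + 1).castSucc * x (i + 1) + a (i + 2).castSucc * x (i + 2)
        + a 3) := fun c => by
    simp only [F, cubic_eq a _ i, cyclicVec_self, cyclicVec_add_one, cyclicVec_add_two]
  have hF0 : F (x i) = 0 := by
    have h := cubic_eq a x i
    rw [hF, ← h]
    exact hx
  have hFc : Filter.Tendsto F (𝓝 (x i)) (𝓝 0) := by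
    have : Continuous F := by
      simp only [funext hF]
      fun_prop
    simpa [hF0] using this.tendsto (x i)
  have h1 : ∀ᶠ c in 𝓝 (x i), ‖F c‖ < (ε / 2) ^ 2 := by
    have := hFc.norm
    rw [norm_zero] at this
    exact this.eventually_lt_const (by positivity)
  filter_upwards [h1, Metric.ball_mem_nhds (x i) hε] with c hc hcε
  let B : ℂ := c * x (i + 1) - a (i + 2).castSucc
  obtain ⟨s, hs⟩ := IsAlgClosed.exists_pow_nat_eq
    ((2 * x (i + 2) + B) ^ 2 - 4 * F c) (n := 2) (by norm_num)
  -- Keep the coordinate of index i + 1 and solve the quadratic equation for the one of index i + 2.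
  -- Its roots are (-B ± s) / 2, and the product of their differences with the old coordinate is F
  -- c, which is small; hence one root is close.
  have hfac : (x (i + 2) - (-B + s) / 2) * (x (i + 2) - (-B - s) / 2) = F c := by
    linear_combination (-1 / 4 : ℂ) * hs
  have hroot : ∀ y, (2 * y + B) ^ 2 = s ^ 2 → cyclicVec i c (x (i + 1)) y ∈ surface a := by
    intro y hy
    change cubic a _ = 0
    simp only [cubic_eq a _ i, cyclicVec_self, cyclicVec_add_one, cyclicVec_add_two]
    have h3 := hF c
    rw [hs] at hy
    simp only [B] at hy
    linear_combination (1 / 4 : ℂ) * hy - h3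
  have hdist : ∀ y, ‖x (i + 2) - y‖ < ε / 2 → dist (cyclicVec i c (x (i + 1)) y) x < ε := by
    intro y hy
    rw [dist_pi_lt_iff hε]
    have key : ∀ j, j = i ∨ j = i + 1 ∨ j = i + 2 := by
      clear * -; revert i; decide
    intro j
    rcases key j with rfl | rfl | rfl
    · simpa using hcε
    · simpa using hε
    · rw [cyclicVec_add_two, dist_comm, dist_eq_norm]
      linarith
  have hsmall : ‖x (i + 2) - (-B + s) / 2‖ < ε / 2 ∨ ‖x (i + 2) - (-B - s) / 2‖ < ε / 2 := by
    by_contra! hcon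
    rw [← hfac, norm_mul] at hc
    nlinarith [hcon.1, hcon.2]
  rcases hsmall with h | h
  · exact ⟨_, hroot _ (by ring), cyclicVec_self _ _ _ _, hdist _ h⟩
  · exact ⟨_, hroot _ (by ring), cyclicVec_self _ _ _ _, hdist _ h⟩

/-- Move xᵢ slightly to a value whose conic is a smooth hyperbola. There `conicConst` ≠ 0, so the
parameter of every point is non-zero and the point is generic. -/
theorem surface_subset_closure_generic (a : Fin 4 → ℂ) (i : Fin 3) :
    surface a ⊆ closure (genericSet a i 1) := by
  intro x hx
  rw [Metric.mem_closure_iff]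
  intro ε hε
  have hbad : ∀ᶠ c in 𝓝[≠] (x i), c ∉ {c : ℂ | ∃ t, t ≠ 0 ∧ c = t + t⁻¹ ∧
      (t ^ 2 - 1 = 0 ∨ conicConst a i t = 0)} :=
    eventually_nhdsNE_notMem_of_finite (finite_bad_values a i) _
  obtain ⟨c, h1, y, hy, hyi, hyx⟩ :=
    (hbad.and ((eventually_exists_near hx i hε).filter_mono nhdsWithin_le_nhds)).exists
  obtain ⟨t, ht, htc⟩ := exists_add_inv_eq c
  have h2 : t ^ 2 - 1 ≠ 0 := fun h => h1 ⟨t, ht, htc, Or.inl h⟩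
  have h3 : conicConst a i t ≠ 0 := fun h => h1 ⟨t, ht, htc, Or.inr h⟩
  have hyt : y i = t + t⁻¹ := hyi.trans htc
  have hz : conicParam a i t y ≠ 0 := by
    intro h0
    have h4 := cubic_eq_conic (a := a) ht h2 hyt
    rw [h0, zero_mul, zero_sub] at h4
    have h5 : cubic a y = 0 := hy
    rw [h5] at h4
    exact h3 (neg_eq_zero.mp h4.symm)
  exact ⟨y, ⟨t, _, ⟨ht, h2, hz, by simp⟩, eq_conicPt ht h2 hyt hy hz⟩, by rwa [dist_comm]⟩

theorem exists_genericParam {x : Fin 3 → ℂ} (hx : x ∈ surface a) (i : Fin 3)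
    (hf : MvPolynomial.eval x f ≠ 0) : ∃ t z, GenericParam a i f t z := by
  have hopen : IsOpen {y : Fin 3 → ℂ | MvPolynomial.eval y f ≠ 0} :=
    isOpen_ne_fun (MvPolynomial.continuous_eval f) continuous_const
  obtain ⟨y, hy, t, z, h, rfl⟩ :=
    mem_closure_iff.mp (surface_subset_closure_generic a i hx) _ hopen hf
  exact ⟨t, z, h.1, h.2.1, h.2.2.1, hy⟩

/-- One point of the surface with f ≠ 0 suffices. On the complex line from an f-generic parameter (s
= 0) to a given generic one (s = 1), all but finitely many parameters are f-generic, so the end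
point is a limit of such points. -/
theorem surface_subset_closure_genericSet {x : Fin 3 → ℂ} (hx : x ∈ surface a) (i : Fin 3)
    (hf : MvPolynomial.eval x f ≠ 0) : surface a ⊆ closure (genericSet a i f) := by
  refine (surface_subset_closure_generic a i).trans
    (closure_minimal ?_ isClosed_closure)
  rintro _ ⟨t, z, h, rfl⟩
  obtain ⟨t₁, z₁, h₁⟩ := exists_genericParam hx i hf
  have hfin := h₁.finite_not (t - t₁) (z - z₁)
  have hcont := continuousAt_conicPt_line (a := a) (i := i) (t := t₁) (z := z₁) (t' := t - t₁)
    (z' := z - z₁) (s := 1) (by simpa using h.1) (by simpa using h.2.1) (by simpa using h.2.2.1)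
  have hlim : Filter.Tendsto (fun s => conicPt a i (t₁ + s * (t - t₁)) (z₁ + s * (z - z₁)))
      (𝓝[≠] (1 : ℂ)) (𝓝 (conicPt a i t z)) := by
    have := hcont.tendsto.mono_left (nhdsWithin_le_nhds (s := {1}ᶜ))
    simpa using this
  refine mem_closure_of_tendsto hlim ?_
  filter_upwards [eventually_nhdsNE_notMem_of_finite hfin 1] with s hs
  exact ⟨_, _, not_not.mp hs, rfl⟩

theorem exists_root_of_unity_notMem {B : Set ℂ} (hB : B.Finite) :
    ∃ (r : ℕ) (t : ℂ), 0 < r ∧ t ^ r = 1 ∧ t ∉ B := by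
  have hinf : {t : ℂ | ∃ r : ℕ, 0 < r ∧ t ^ r = 1}.Infinite := by
    refine Set.infinite_of_injective_forall_mem
      (f := fun n : ℕ => Complex.exp (2 * Real.pi * Complex.I / ((n + 1 : ℕ) : ℂ))) ?_ ?_
    · intro n m hnm
      have h1 := (Complex.isPrimitiveRoot_exp (n + 1) (by omega)).eq_orderOf
      have h2 := (Complex.isPrimitiveRoot_exp (m + 1) (by omega)).eq_orderOf
      simp only at hnm
      rw [hnm, ← h2] at h1
      omega
    · intro n
      exact ⟨n + 1, by omega, (Complex.isPrimitiveRoot_exp (n + 1) (by omega)).pow_eq_one⟩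
  obtain ⟨t, ⟨r, hr, ht⟩, hB⟩ := hinf.exists_notMem_finite hB
  exact ⟨r, t, hr, ht, hB⟩

variable {U : Set (surface a)}

theorem IsZariskiOpen.exists_polynomial (hU : IsZariskiOpen a U) (hne : U.Nonempty) :
    ∃ f : MvPolynomial (Fin 3) ℂ, (∃ p : surface a, MvPolynomial.eval (p : Fin 3 → ℂ) f ≠ 0) ∧
      ∀ p : surface a, MvPolynomial.eval (p : Fin 3 → ℂ) f ≠ 0 → p ∈ U := by
  obtain ⟨I, hI⟩ := hU
  obtain ⟨p, hp⟩ := hne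
  have h := mt (hI p).mpr (not_not.mpr hp)
  push Not at h
  obtain ⟨f, hf, hfp⟩ := h
  refine ⟨f, ⟨p, hfp⟩, fun p' hp' => ?_⟩
  by_contra hcon
  exact hp' ((hI p').mp hcon f hf)

/-- The smooth part of a Zariski open subset of the surface is connected. -/
theorem IsZariskiOpen.isPreconnected_smooth (hU : IsZariskiOpen a U) (hne : U.Nonempty) :
    IsPreconnected {p | p ∈ U ∧ IsSmoothPt a p} := by
  obtain ⟨f, ⟨p, hp⟩, hf⟩ := hU.exists_polynomial hne
  rw [← IsInducing.subtypeVal.isPreconnected_image]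
  -- The smooth part of U lies between a connected set and its closure.
  refine (isPreconnected_genericSet a 0 f).subset_closure ?_ ?_
  · rintro _ ⟨t, z, h, rfl⟩
    exact ⟨⟨_, conicPt_mem h.1 h.2.1 h.2.2.1⟩,
      ⟨hf _ h.2.2.2, grad_conicPt_ne_zero h.1 h.2.1 h.2.2.1⟩, rfl⟩
  · rintro _ ⟨p', -, rfl⟩
    exact surface_subset_closure_genericSet p.2 0 hp p'.2

/-- There is a smooth point of `U` on a conic `xᵢ = t + t⁻¹` with `t` a root of unity. -/
theorem IsZariskiOpen.exists_periodic (hU : IsZariskiOpen a U) (hne : U.Nonempty) (i : Fin 3) :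
    ∃ (r : ℕ) (t : ℂ) (p : surface a), 0 < r ∧ t ^ r = 1 ∧ t ≠ 0 ∧ t ^ 2 - 1 ≠ 0 ∧ p ∈ U ∧
      IsSmoothPt a p ∧ (p : Fin 3 → ℂ) i = t + t⁻¹ ∧ conicParam a i t p ≠ 0 := by
  obtain ⟨f, ⟨p, hp⟩, hf⟩ := hU.exists_polynomial hne
  obtain ⟨t, z, h⟩ := exists_genericParam p.2 i hp
  -- With z fixed, only finitely many t are excluded, while roots of unity are infinite in number.
  obtain ⟨r, t₀, hr, ht₀, hB⟩ := exists_root_of_unity_notMem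
    ((h.finite_not 1 0).image fun s => t + s)
  have hg : GenericParam a i f t₀ z := by
    by_contra hcon
    exact hB ⟨t₀ - t, by simpa using hcon, by simp⟩
  refine ⟨r, t₀, ⟨_, conicPt_mem hg.1 hg.2.1 hg.2.2.1⟩, hr, ht₀, hg.1, hg.2.1, hf _ hg.2.2.2,
    grad_conicPt_ne_zero hg.1 hg.2.1 hg.2.2.1, by simp [conicPt], ?_⟩
  rw [conicParam_conicPt]
  exact hg.2.2.1

end Generic

/-! ### The quadratic differentials `(dxᵢ)² / (xᵢ² - 4)` are constant in the affine charts -/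

section Twisting

variable {a : Fin 4 → ℂ}

/-- Near `q`, the quadratic differential `(dxᵢ)² / (xᵢ² - 4)` is constant in the chart. -/
def HolChart.HasConstDiff (c : HolChart a) (i : Fin 3) (q : ℂ × ℂ) : Prop :=
  ∃ β : ℂ × ℂ → ℂ, ∀ᶠ q' in 𝓝 q, ∀ x,
    fderiv ℂ (c.coord i) q' x ^ 2 = β x * (c.coord i q' ^ 2 - 4)

/-- A local inverse of `τ ↦ t₀ exp τ + (t₀ exp τ)⁻¹`. -/
theorem exists_log_branch {t₀ : ℂ} (h0 : t₀ ≠ 0) (h1 : t₀ ^ 2 - 1 ≠ 0) :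
    ∃ τ : ℂ → ℂ, AnalyticAt ℂ τ (t₀ + t₀⁻¹) ∧ τ (t₀ + t₀⁻¹) = 0 ∧
      ∀ c, c = t₀ * Complex.exp (τ c) + (t₀ * Complex.exp (τ c))⁻¹ := by
  have hr0 := sub_inv_ne_zero h0 h1
  set r₀ : ℂ := t₀ - t₀⁻¹ with hr₀
  -- A square root of c² - 4, normalized to be t₀ - t₀⁻¹ at the base point. The principal power is
  -- applied to a quantity equal to 1 there, hence away from the cut. The algebraic identity r² = c²
  -- - 4 holds for all c, analyticity only near the base point.
  let r : ℂ → ℂ := fun c => r₀ * ((c ^ 2 - 4) / r₀ ^ 2) ^ (((2 : ℕ) : ℂ)⁻¹)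
  have hr : ∀ c, r c ^ 2 = c ^ 2 - 4 := fun c => by
    simp only [r, mul_pow, Complex.cpow_nat_inv_pow _ two_ne_zero]
    field_simp
  have hv : ((t₀ + t₀⁻¹) ^ 2 - 4) / r₀ ^ 2 = 1 := by
    rw [div_eq_one_iff_eq (pow_ne_zero 2 hr0), hr₀]
    field_simp
    ring
  have hrc : r (t₀ + t₀⁻¹) = r₀ := by simp only [r, hv, Complex.one_cpow, mul_one]
  have hra : AnalyticAt ℂ r (t₀ + t₀⁻¹) := by
    refine analyticAt_const.mul (AnalyticAt.cpow ?_ analyticAt_const ?_)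
    · exact ((analyticAt_id.pow 2).sub analyticAt_const).div analyticAt_const (pow_ne_zero 2 hr0)
    · rw [hv]
      exact Complex.one_mem_slitPlane
  have hprod : ∀ c, ((c + r c) / 2) * ((c - r c) / 2) = 1 := fun c => by
    linear_combination -hr c / 4
  have ht0 : (t₀ + t₀⁻¹ + r (t₀ + t₀⁻¹)) / 2 / t₀ = 1 := by
    rw [hrc, hr₀]
    field_simp
    ring
  refine ⟨fun c => Complex.log ((c + r c) / 2 / t₀), ?_, ?_, ?_⟩
  · refine AnalyticAt.clog ?_ ?_
    · exact ((analyticAt_id.add hra).div analyticAt_const two_ne_zero).div analyticAt_const h0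
    · rw [ht0]
      exact Complex.one_mem_slitPlane
  · simp only [ht0, Complex.log_one]
  · intro c
    have hne : (c + r c) / 2 ≠ 0 := left_ne_zero_of_mul_eq_one (hprod c)
    have hexp : t₀ * Complex.exp (Complex.log ((c + r c) / 2 / t₀)) = (c + r c) / 2 := by
      rw [Complex.exp_log (div_ne_zero hne h0)]
      field_simp
    simp only [hexp]
    rw [← eq_inv_of_mul_eq_one_right (hprod c)]
    ring

/-- Symplectic coordinates adapted to the conic fibration: the twist `σⱼ ∘ σₖ` becomes linear, and
therefore `(dxᵢ)² / (xᵢ² - 4)` is constant in an affine chart. -/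
theorem HolChart.IsSymplectic.hasConstDiff_of_twist {c : HolChart a} (hc : c.IsSymplectic)
    {i : Fin 3} {t₀ : ℂ} (h0 : t₀ ≠ 0) (h1 : t₀ ^ 2 - 1 ≠ 0) {q₀ : ℂ × ℂ}
    (hq₀ : q₀ ∈ c.toHomeo.target) (hi : c.coord i q₀ = t₀ + t₀⁻¹)
    (hz : conicParam a i t₀ (c.param q₀) ≠ 0) {m : ℕ} (hm : 0 < m) (htm : (t₀ ^ 2) ^ m = 1)
    {f : ℂ × ℂ → ℂ × ℂ} (hf : f ∈ Aff1) (hfq : f q₀ = q₀)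
    (hconj : ∀ᶠ q in 𝓝 q₀, c.param (f q) =
      ((sigma a (i + 1) * sigma a (i + 2)) ^ m) (c.toHomeo.symm q)) :
    c.HasConstDiff i q₀ := by
  obtain ⟨τ, hτa, hτ0, hτ⟩ := exists_log_branch h0 h1
  set z₀ := conicParam a i t₀ (c.param q₀) with hz₀
  let T : ℂ × ℂ → ℂ := fun q => τ (c.coord i q)
  let t : ℂ × ℂ → ℂ := fun q => t₀ * Complex.exp (T q)
  let Z : ℂ × ℂ → ℂ := fun q => conicParam a i (t q) (c.param q)
  let ζ : ℂ × ℂ → ℂ := fun q => Complex.log (Z q / z₀)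
  have hco := fun j => c.analyticOnNhd_coord j q₀ hq₀
  have hTa : AnalyticAt ℂ T q₀ := by
    have h : AnalyticAt ℂ τ (c.coord i q₀) := by rwa [hi]
    exact h.comp (hco i)
  have hT0 : T q₀ = 0 := by simp only [T, hi, hτ0]
  have ht0 : t q₀ = t₀ := by simp only [t, hT0, Complex.exp_zero, mul_one]
  have hta : AnalyticAt ℂ t q₀ := analyticAt_const.mul hTa.cexp
  have htne : ∀ q, t q ≠ 0 := fun q => mul_ne_zero h0 (Complex.exp_ne_zero _)
  have hti : ∀ q, c.coord i q = t q + (t q)⁻¹ := fun q => hτ _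
  have hca : ∀ s : ℂ, s ^ 2 - 1 ≠ 0 → AnalyticAt ℂ (conicCenter₁ a i) s := fun s hs =>
    (analyticAt_id.mul ((analyticAt_const.mul analyticAt_id).sub analyticAt_const)).mul
      (((analyticAt_id.pow 2).sub analyticAt_const).inv hs)
  have hZa : AnalyticAt ℂ Z q₀ := by
    have h : AnalyticAt ℂ (conicCenter₁ a i) (t q₀) := by
      rw [ht0]
      exact hca t₀ h1
    exact ((hco (i + 1)).add (hta.mul (hco (i + 2)))).sub (h.comp hta)
  have hZ0 : Z q₀ = z₀ := by simp only [Z, ht0, hz₀]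
  have hZ1 : Z q₀ / z₀ = 1 := by rw [hZ0, div_self hz]
  have hZda : AnalyticAt ℂ (fun q => Z q / z₀) q₀ := hZa.div analyticAt_const hz
  have hslit : ∀ᶠ q in 𝓝 q₀, Z q / z₀ ∈ Complex.slitPlane := by
    refine hZda.continuousAt.eventually_mem ?_
    rw [hZ1]
    exact Complex.isOpen_slitPlane.mem_nhds Complex.one_mem_slitPlane
  have hζa : AnalyticAt ℂ ζ q₀ := hZda.clog (by rw [hZ1]; exact Complex.one_mem_slitPlane)
  have hζ0 : ζ q₀ = 0 := by simp only [ζ, hZ1, Complex.log_one]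
  have hreg : ∀ᶠ q in 𝓝 q₀, t q ^ 2 - 1 ≠ 0 := by
    have : ContinuousAt (fun q => t q ^ 2 - 1) q₀ := (hta.continuousAt.pow 2).sub continuousAt_const
    exact this.eventually_ne (by rw [ht0]; exact h1)
  have htarget := c.toHomeo.open_target.mem_nhds hq₀
  have hDt : ∀ q, AnalyticAt ℂ T q → HasFDerivAt t (t q • fderiv ℂ T q) q := by
    intro q hTq
    have h : HasFDerivAt t (t₀ • (Complex.exp (T q) • fderiv ℂ T q)) q :=
      hTq.differentiableAt.hasFDerivAt.cexp.const_mul t₀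
    rwa [smul_smul] at h
  have hDi : ∀ q, AnalyticAt ℂ T q → ∀ x,
      fderiv ℂ (c.coord i) q x = (t q - (t q)⁻¹) * fderiv ℂ T q x := by
    intro q hTq x
    have ht' := hDt q hTq
    have h2 : HasFDerivAt (c.coord i) _ q := (ht'.add ((hasDerivAt_inv (htne q)).comp_hasFDerivAt
      q ht')).congr_of_eventuallyEq (Filter.Eventually.of_forall hti)
    rw [h2.fderiv]
    have h4 := htne q
    simp only [add_apply, smul_apply, smul_eq_mul]
    field_simp
    ring
  have hconj' : ∀ᶠ q in 𝓝 q₀, T (f q) = T q ∧ Z (f q) = ((t q ^ 2)⁻¹) ^ m * Z q := by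
    filter_upwards [hconj, hreg] with q hq hr
    obtain ⟨e1, e2⟩ := conicParam_sigma_pow (htne q) hr (p := c.toHomeo.symm q) (hti q) m
    have hT' : T (f q) = T q := by
      have : c.coord i (f q) = c.coord i q := by
        rw [hti q, ← e1, ← hq]
        rfl
      simp only [T, this]
    refine ⟨hT', ?_⟩
    have ht' : t (f q) = t q := by simp only [t, hT']
    simp only [Z, ht', hq]
    exact e2
  -- The condition t₀²ᵐ = 1 removes the constant factor, so the multiplier of Z is exactly exp
  -- (-2mT) and the twist is linear in (T, ζ).
  have hexp : ∀ q, ((t q ^ 2)⁻¹) ^ m = Complex.exp (-(2 * m) * T q) := by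
    intro q
    simp only [t, mul_pow, inv_pow]
    rw [htm, one_mul, ← Complex.exp_nat_mul, ← Complex.exp_nat_mul, ← Complex.exp_neg]
    congr 1
    push_cast
    ring
  obtain ⟨β, hβ⟩ := exists_fderiv_sq_eq_of_twist (ε := -1) (N := -(2 * m)) hTa hζa (by norm_num)
    (by simpa using hm.ne') (by
      filter_upwards [hslit, hreg, htarget, hTa.eventually_analyticAt] with q hs hr hqt hTq x y
      have ht' := hDt q hTq
      have d1 := (c.differentiableAt_coord (i + 1) hqt).hasFDerivAt
      have d2 := (c.differentiableAt_coord (i + 2) hqt).hasFDerivAt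
      have hcen := (hca (t q) hr).differentiableAt.hasDerivAt
      have hZ' : HasFDerivAt Z _ q := (d1.add (ht'.mul d2)).sub (hcen.comp_hasFDerivAt q ht')
      have hζ' : HasFDerivAt ζ _ q := (hZ'.mul_const z₀⁻¹).clog hs
      have hZne : Z q ≠ 0 := by
        intro h
        rw [h, zero_div] at hs
        simp at hs
      have hDζ : ∀ v, fderiv ℂ ζ q v * Z q = fderiv ℂ (c.coord (i + 1)) q v +
          t q * fderiv ℂ (c.coord (i + 2)) q v +
          (c.coord (i + 2) q * t q - deriv (conicCenter₁ a i) (t q) * t q) * fderiv ℂ T q v := by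
        intro v
        rw [hζ'.fderiv]
        simp only [add_apply, sub_apply, smul_apply, smul_eq_mul]
        field_simp
        ring
      have w1 := hc.wedge' hqt i x y
      have w2 := hc.wedge'' hqt i x y
      rw [hDi q hTq, hDi q hTq] at w1 w2
      -- Modulo dT, Z dζ is dxⱼ + t dxₖ. So dxᵢ ∧ Z dζ = (Pₖ - t Pⱼ) du ∧ dv = -(t - t⁻¹) Z du ∧ dv,
      -- and dxᵢ = (t - t⁻¹) dT gives the Jacobian -1.
      have hg : _ = -(t q - (t q)⁻¹) * Z q :=
        grad_sub_grad (a := a) (htne q) hr (x := c.param q) (hti q)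
      apply mul_left_cancel₀ (mul_ne_zero (sub_inv_ne_zero (htne q) hr) hZne)
      linear_combination (t q - (t q)⁻¹) * (fderiv ℂ T q x * hDζ y - fderiv ℂ T q y * hDζ x)
        + w2 - t q * w1 + (x.1 * y.2 - x.2 * y.1) * hg) hf hfq (hconj'.mono fun q hq => hq.1) (by
      have hcont : ContinuousAt (fun q => (ζ q + -(2 * m) * T q).im) q₀ :=
        Complex.continuous_im.continuousAt.comp
          (hζa.continuousAt.add (continuousAt_const.mul hTa.continuousAt))
      -- Multiplicativity of Z becomes additivity of ζ only on the right branch of the logarithm;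
      -- near q₀ the candidate value is close to 0, so no multiple of 2πi appears.
      have him : ∀ᶠ q in 𝓝 q₀, (ζ q + -(2 * m) * T q).im ∈ Set.Ioo (-Real.pi) Real.pi := by
        refine hcont.eventually_mem (Ioo_mem_nhds ?_ ?_) <;> simp [hζ0, hT0, Real.pi_pos]
      filter_upwards [hconj', hslit, him] with q hq hs hi
      rw [← Complex.log_exp hi.1 hi.2.le, Complex.exp_add,
        Complex.exp_log (Complex.slitPlane_ne_zero hs), ← hexp, mul_comm]
      simp only [ζ, hq.2, mul_div_assoc])
  refine ⟨fun x => β x, ?_⟩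
  filter_upwards [hβ, hTa.eventually_analyticAt] with q hq hTq x
  rw [hDi q hTq, mul_pow, hq, hti q]
  have h4 := htne q
  field_simp
  ring

end Twisting

/-! ### Propagation along the surface -/

section Propagation

variable {a : Fin 4 → ℂ} {U : Set (surface a)}

theorem HolChart.param_apply (c : HolChart a) {p : surface a} (hp : p ∈ c.toHomeo.source) :
    c.param (c.toHomeo p) = p := by
  rw [HolChart.param, c.toHomeo.left_inv hp]

/-- Some point of `U` has a chart in which `(dxᵢ)² / (xᵢ² - 4)` is locally constant. -/
theorem AffineStructure.IsInvariant.exists_hasConstDiff {A : AffineStructure a U}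
    {G : Subgroup (Equiv.Perm (surface a))} (hinv : A.IsInvariant G)
    (hfin : G.IsFiniteRelIndex (Gamma2 a)) (hU : IsZariskiOpen a U) (hne : U.Nonempty)
    (i : Fin 3) : ∃ p, p ∈ U ∧ IsSmoothPt a p ∧ ∃ c ∈ A.atlas, p ∈ c.toHomeo.source ∧
      c.HasConstDiff i (c.toHomeo p) := by
  obtain ⟨r, t, p, hr, htr, h0, h1, hpU, hps, hpi, hz⟩ := hU.exists_periodic hne i
  refine ⟨p, hpU, hps, ?_⟩
  obtain ⟨c, hcA, hpc⟩ := A.cover p hpU hps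
  refine ⟨c, hcA, hpc, ?_⟩
  -- Finite index puts gⁿ in G. Raising to the order r of the root of unity makes the multiplier
  -- t⁻²ⁿʳ equal to 1, so the conic through p is fixed and the affine map has a fixed point.
  obtain ⟨n, hn, -, hnG⟩ := Subgroup.exists_pow_mem_of_relIndex_ne_zero
    hfin.relIndex_ne_zero (sigma_mul_sigma_mem a i)
  set g := sigma a (i + 1) * sigma a (i + 2) with hg
  have hgG : g ^ (n * r) ∈ G := by
    rw [pow_mul]
    exact pow_mem hnG.1 r
  have htm : (t ^ 2) ^ (n * r) = 1 := by
    rw [← pow_mul, show 2 * (n * r) = r * (2 * n) by ring, pow_mul, htr, one_pow]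
  have hfix : (g ^ (n * r)) p = p := by
    obtain ⟨e1, e2⟩ := conicParam_sigma_pow h0 h1 hpi (n * r)
    rw [inv_pow, htm, inv_one, one_mul] at e2
    refine Subtype.ext ?_
    rw [eq_conicPt h0 h1 hpi p.2 hz]
    have h := eq_conicPt h0 h1 e1 ((g ^ (n * r)) p).2 (by rw [e2]; exact hz)
    rw [e2] at h
    exact h
  have hsrc : (g ^ (n * r)) p ∈ c.toHomeo.source := by rwa [hfix]
  obtain ⟨f, hf, hfe⟩ := hinv _ hgG c hcA c hcA p hpc hsrc
  have hq₀ := c.toHomeo.map_source hpc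
  have hparam := c.param_apply hpc
  refine (A.symplectic c hcA).hasConstDiff_of_twist h0 h1 hq₀ (by rw [HolChart.coord, hparam, hpi])
    (by rwa [hparam]) (Nat.mul_pos hn hr) htm hf (by rw [← hfe.self_of_nhds, hfix]) ?_
  have hsymm : Filter.Tendsto c.toHomeo.symm (𝓝 (c.toHomeo p)) (𝓝 p) := by
    have := (c.toHomeo.continuousAt_symm hq₀).tendsto
    rwa [c.toHomeo.left_inv hpc] at this
  have hsrc' : ∀ᶠ p' in 𝓝 p, (g ^ (n * r)) p' ∈ c.toHomeo.source :=
    (continuous_sigma_pow a _ _ _).continuousAt.eventually_mem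
      (c.toHomeo.open_source.mem_nhds hsrc)
  filter_upwards [hsymm.eventually hfe, hsymm.eventually hsrc',
    c.toHomeo.open_target.mem_nhds hq₀] with q e1 e2 e3
  rw [c.toHomeo.right_inv e3] at e1
  rw [← e1, HolChart.param, c.toHomeo.left_inv e2]

/-- An affine transition map has constant differential L, so a constant quadratic form pulls back to
a constant one. -/
theorem HolChart.HasConstDiff.transition {A : AffineStructure a U} {c c' : HolChart a}
    (hc : c ∈ A.atlas) (hc' : c' ∈ A.atlas) {p : surface a} (hp : p ∈ c.toHomeo.source)
    (hp' : p ∈ c'.toHomeo.source) {i : Fin 3} (h : c.HasConstDiff i (c.toHomeo p)) :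
    c'.HasConstDiff i (c'.toHomeo p) := by
  obtain ⟨f, hf, hfe⟩ := A.transition c' hc' c hc p ⟨hp', hp⟩
  obtain ⟨β, hβ⟩ := h
  obtain ⟨k, l, m, o, t, s, -, rfl⟩ := hf
  let L : ℂ × ℂ →L[ℂ] ℂ × ℂ :=
    (k • ContinuousLinearMap.fst ℂ ℂ ℂ + l • ContinuousLinearMap.snd ℂ ℂ ℂ).prod
      (m • ContinuousLinearMap.fst ℂ ℂ ℂ + o • ContinuousLinearMap.snd ℂ ℂ ℂ)
  set f : ℂ × ℂ → ℂ × ℂ := fun q => (k * q.1 + l * q.2 + t, m * q.1 + o * q.2 + s) with hf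
  have hfL : f = fun q => L q + (t, s) := by
    funext q
    simp [hf, L]
  have hfd : ∀ q, HasFDerivAt f L q := fun q => by
    rw [hfL]
    exact L.hasFDerivAt.add_const _
  have hq₀ := c'.toHomeo.map_source hp'
  have hsymm : Filter.Tendsto c'.toHomeo.symm (𝓝 (c'.toHomeo p)) (𝓝 p) := by
    have := (c'.toHomeo.continuousAt_symm hq₀).tendsto
    rwa [c'.toHomeo.left_inv hp'] at this
  have hev : ∀ᶠ q in 𝓝 (c'.toHomeo p), c'.coord i q = c.coord i (f q) := by
    filter_upwards [hsymm.eventually hfe, hsymm.eventually (c.toHomeo.open_source.mem_nhds hp),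
      c'.toHomeo.open_target.mem_nhds hq₀] with q e1 e2 e3
    rw [c'.toHomeo.right_inv e3] at e1
    rw [HolChart.coord, HolChart.coord, HolChart.param, HolChart.param, ← e1,
      c.toHomeo.left_inv e2]
  have hfp : f (c'.toHomeo p) = c.toHomeo p := hfe.self_of_nhds.symm
  have hft : Filter.Tendsto f (𝓝 (c'.toHomeo p)) (𝓝 (c.toHomeo p)) := by
    rw [← hfp]
    exact (hfd _).continuousAt.tendsto
  refine ⟨fun x => β (L x), ?_⟩
  filter_upwards [hev, hev.eventually_nhds, hft.eventually hβ,
    hft.eventually (c.toHomeo.open_target.mem_nhds (c.toHomeo.map_source hp))] with q e1 e2 e3 e4 x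
  have hd : HasFDerivAt (c'.coord i) ((fderiv ℂ (c.coord i) (f q)).comp L) q :=
    ((c.differentiableAt_coord i e4).hasFDerivAt.comp q (hfd q)).congr_of_eventuallyEq e2
  rw [hd.fderiv, e1]
  exact e3 (L x)

/-- Identity principle: for each fixed x both sides are analytic in the point. -/
theorem HolChart.fderiv_sq_eq_of_isPreconnected (c : HolChart a) {i : Fin 3} {V : Set (ℂ × ℂ)}
    (hVc : IsPreconnected V) (hVt : V ⊆ c.toHomeo.target) {q : ℂ × ℂ} (hq : q ∈ V)
    {β : ℂ × ℂ → ℂ} (hβ : ∀ᶠ q' in 𝓝 q, ∀ x,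
      fderiv ℂ (c.coord i) q' x ^ 2 = β x * (c.coord i q' ^ 2 - 4)) :
    ∀ q' ∈ V, ∀ x, fderiv ℂ (c.coord i) q' x ^ 2 = β x * (c.coord i q' ^ 2 - 4) := by
  intro q' hq' x
  have hco := (c.analyticOnNhd_coord i).mono hVt
  have h1 : AnalyticOnNhd ℂ (fun q => fderiv ℂ (c.coord i) q x ^ 2) V := fun q hq =>
    (((ContinuousLinearMap.apply ℂ ℂ x).analyticAt _).comp (hco q hq).fderiv).pow 2
  have h2 : AnalyticOnNhd ℂ (fun q => β x * (c.coord i q ^ 2 - 4)) V := fun q hq =>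
    analyticAt_const.mul (((hco q hq).pow 2).sub analyticAt_const)
  exact h1.eqOn_of_preconnected_of_eventuallyEq h2 hVc hq (hβ.mono fun q hq => hq x) hq'

theorem HolChart.HasConstDiff.of_isPreconnected {c : HolChart a} {i : Fin 3} {V : Set (ℂ × ℂ)}
    (hV : IsOpen V) (hVc : IsPreconnected V) (hVt : V ⊆ c.toHomeo.target) {q q' : ℂ × ℂ}
    (hq : q ∈ V) (hq' : q' ∈ V) (h : c.HasConstDiff i q) : c.HasConstDiff i q' := by
  obtain ⟨β, hβ⟩ := h
  have h1 := c.fderiv_sq_eq_of_isPreconnected hVc hVt hq hβ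
  exact ⟨β, Filter.eventually_of_mem (hV.mem_nhds hq') h1⟩

/-- The property holds near one smooth point of U, and its validity is locally constant: on a small
ball in a chart the identity principle transfers it between any two points, and transition maps
carry it between charts. The smooth part of U is connected. -/
theorem AffineStructure.IsInvariant.hasConstDiff {A : AffineStructure a U}
    {G : Subgroup (Equiv.Perm (surface a))} (hinv : A.IsInvariant G)
    (hfin : G.IsFiniteRelIndex (Gamma2 a)) (hU : IsZariskiOpen a U) (hne : U.Nonempty)
    (i : Fin 3) {c : HolChart a} (hc : c ∈ A.atlas) {q : ℂ × ℂ} (hq : q ∈ c.toHomeo.target) :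
    c.HasConstDiff i q := by
  let Q : surface a → Prop := fun p =>
    ∃ c ∈ A.atlas, p ∈ c.toHomeo.source ∧ c.HasConstDiff i (c.toHomeo p)
  obtain ⟨p₀, hp₀U, hp₀s, hQ₀⟩ := hinv.exists_hasConstDiff hfin hU hne i
  have hps := c.toHomeo.map_target hq
  have hQ : Q p₀ ↔ Q (c.toHomeo.symm q) := by
    refine (hU.isPreconnected_smooth hne).induction₂ (fun p p' => Q p ↔ Q p') ?_
      (fun _ _ _ _ _ _ => Iff.trans) (fun _ _ _ _ => Iff.symm) ⟨hp₀U, hp₀s⟩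
      ⟨A.source_subset c hc hps, c.smooth _ hps⟩
    rintro p ⟨hpU, hp⟩
    obtain ⟨d, hd, hpd⟩ := A.cover p hpU hp
    obtain ⟨r, hr, hball⟩ := Metric.isOpen_iff.mp d.toHomeo.open_target _ (d.toHomeo.map_source hpd)
    have hmem : ∀ᶠ p' in 𝓝 p, d.toHomeo p' ∈ Metric.ball (d.toHomeo p) r :=
      (d.toHomeo.continuousAt hpd).eventually_mem (Metric.ball_mem_nhds _ hr)
    have hB := (convex_ball (d.toHomeo p) r).isPreconnected
    filter_upwards [mem_nhdsWithin_of_mem_nhds hmem,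
      mem_nhdsWithin_of_mem_nhds (d.toHomeo.open_source.mem_nhds hpd)] with p' h1 h2
    constructor
    · rintro ⟨e, he, hpe, h⟩
      exact ⟨d, hd, h2, (h.transition he hd hpe hpd).of_isPreconnected Metric.isOpen_ball hB hball
        (Metric.mem_ball_self hr) h1⟩
    · rintro ⟨e, he, hpe, h⟩
      exact ⟨d, hd, hpd, (h.transition he hd hpe h2).of_isPreconnected Metric.isOpen_ball hB hball
        h1 (Metric.mem_ball_self hr)⟩
  obtain ⟨e, he, hpe, h⟩ := hQ.mp hQ₀
  have := h.transition he hc hpe hps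
  rwa [c.toHomeo.right_inv hq] at this

theorem eq_zero_or_eq_zero_of_mul_eq_zero {E : Type*} [AddCommGroup E] [Module ℂ E]
    (l m : E →ₗ[ℂ] ℂ) (h : ∀ x, l x * m x = 0) : l = 0 ∨ m = 0 := by
  by_contra! hcon
  obtain ⟨x, hx⟩ := DFunLike.ne_iff.mp hcon.1
  obtain ⟨y, hy⟩ := DFunLike.ne_iff.mp hcon.2
  rw [LinearMap.zero_apply] at hx hy
  have h1 : m x = 0 := (mul_eq_zero.mp (h x)).resolve_left hx
  have h2 : l y = 0 := (mul_eq_zero.mp (h y)).resolve_right hy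
  have h3 := h (x + y)
  rw [map_add, map_add, h1, h2, add_zero, zero_add] at h3
  exact mul_ne_zero hx hy h3

/-- In an affine chart, `dxᵢ = ρ l` with `l` a constant form and `ρ² = xᵢ² - 4`. -/
theorem HolChart.IsSymplectic.exists_linear_form {c : HolChart a} (hc : c.IsSymplectic) {i : Fin 3}
    (h : ∀ q ∈ c.toHomeo.target, c.HasConstDiff i q) {V : Set (ℂ × ℂ)} (hV : IsOpen V)
    (hVc : IsPreconnected V) (hVt : V ⊆ c.toHomeo.target) (hne : V.Nonempty) :
    ∃ l : ℂ × ℂ →ₗ[ℂ] ℂ, ∀ q ∈ V, ∃ ρ : ℂ, ρ ^ 2 = c.coord i q ^ 2 - 4 ∧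
      ∀ x, fderiv ℂ (c.coord i) q x = ρ * l x := by
  -- The form l is dxᵢ / ρ₁ at a point q₁ where the normalizing factor ρ₁ can be inverted.
  obtain ⟨q₁, hq₁, h4⟩ := hc.exists_sq_ne_four hV hVt hne i
  obtain ⟨β, hβ⟩ := h q₁ (hVt hq₁)
  obtain ⟨ρ₁, hρ₁⟩ := IsAlgClosed.exists_pow_nat_eq (c.coord i q₁ ^ 2 - 4) (n := 2) (by norm_num)
  have hρ0 : ρ₁ ≠ 0 := by
    rintro rfl
    exact h4 (by rw [← hρ₁]; norm_num)
  refine ⟨ρ₁⁻¹ • (fderiv ℂ (c.coord i) q₁ : ℂ × ℂ →ₗ[ℂ] ℂ), fun q hq => ?_⟩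
  have hall := c.fderiv_sq_eq_of_isPreconnected hVc hVt hq₁ hβ
  have hl : ∀ x, β x = (ρ₁⁻¹ • (fderiv ℂ (c.coord i) q₁ : ℂ × ℂ →ₗ[ℂ] ℂ)) x ^ 2 := by
    intro x
    have := hall q₁ hq₁ x
    rw [← hρ₁] at this
    rw [LinearMap.smul_apply, ContinuousLinearMap.coe_coe, smul_eq_mul, mul_pow, this]
    field_simp
  set l := ρ₁⁻¹ • (fderiv ℂ (c.coord i) q₁ : ℂ × ℂ →ₗ[ℂ] ℂ)
  obtain ⟨ρ, hρ⟩ := IsAlgClosed.exists_pow_nat_eq (c.coord i q ^ 2 - 4) (n := 2) (by norm_num)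
  -- From (dxᵢ)² = ρ² l² the product of the linear forms dxᵢ - ρl and dxᵢ + ρl vanishes, so one of
  -- them is zero. The sign is chosen separately at each point.
  rcases eq_zero_or_eq_zero_of_mul_eq_zero ((fderiv ℂ (c.coord i) q : ℂ × ℂ →ₗ[ℂ] ℂ) - ρ • l)
    ((fderiv ℂ (c.coord i) q : ℂ × ℂ →ₗ[ℂ] ℂ) + ρ • l) (fun x => by
      have := hall q hq x
      rw [hl, ← hρ] at this
      simp only [LinearMap.sub_apply, LinearMap.add_apply, LinearMap.smul_apply,
        ContinuousLinearMap.coe_coe, smul_eq_mul]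
      linear_combination this) with h0 | h0
  · refine ⟨ρ, hρ, fun x => ?_⟩
    have := LinearMap.congr_fun h0 x
    simp only [LinearMap.sub_apply, LinearMap.smul_apply,
        ContinuousLinearMap.coe_coe, smul_eq_mul, LinearMap.zero_apply] at this
    linear_combination this
  · refine ⟨-ρ, by rw [neg_sq, hρ], fun x => ?_⟩
    have := LinearMap.congr_fun h0 x
    simp only [LinearMap.add_apply, LinearMap.smul_apply,
        ContinuousLinearMap.coe_coe, smul_eq_mul, LinearMap.zero_apply] at this
    linear_combination this

theorem linearIndependent_pair_of_wedge {l m : ℂ × ℂ →ₗ[ℂ] ℂ} {x y : ℂ × ℂ}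
    (h : l x * m y - l y * m x ≠ 0) : LinearIndependent ℂ ![l, m] := by
  rw [LinearIndependent.pair_iff]
  intro s t hst
  have h1 := LinearMap.congr_fun hst x
  have h2 := LinearMap.congr_fun hst y
  simp only [LinearMap.add_apply, LinearMap.smul_apply, smul_eq_mul, LinearMap.zero_apply] at h1 h2
  constructor
  · refine (mul_eq_zero.mp ?_).resolve_right h
    linear_combination m y * h1 - m x * h2
  · refine (mul_eq_zero.mp ?_).resolve_right h
    linear_combination l x * h2 - l y * h1

theorem exists_third_index {i j : Fin 3} (h : i ≠ j) :
    ∃ k : Fin 3, (i = k + 1 ∧ j = k + 2) ∨ (i = k + 2 ∧ j = k + 1) := by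
  revert i j; decide

/-- The web is parallel in the connected open subsets of the symplectic charts in which the
differentials `(dxᵢ)² / (xᵢ² - 4)` are constant. -/
theorem HolChart.IsSymplectic.isParallelWeb {c : HolChart a} (hc : c.IsSymplectic)
    (h : ∀ i, ∀ q ∈ c.toHomeo.target, c.HasConstDiff i q) {V : Set (ℂ × ℂ)} (hV : IsOpen V)
    (hVc : IsPreconnected V) (hVt : V ⊆ c.toHomeo.target) : c.IsParallelWeb V := by
  rcases V.eq_empty_or_nonempty with rfl | hne
  · refine ⟨![LinearMap.fst ℂ ℂ ℂ, LinearMap.snd ℂ ℂ ℂ, LinearMap.fst ℂ ℂ ℂ + LinearMap.snd ℂ ℂ ℂ],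
      fun i => ⟨?_, by simp⟩, fun i j hij => ?_⟩
    · intro h0
      have h1 := LinearMap.congr_fun h0 (1, 0)
      have h2 := LinearMap.congr_fun h0 (0, 1)
      fin_cases i <;> simp at h1 h2
    · apply linearIndependent_pair_of_wedge (x := (1, 0)) (y := (0, 1))
      fin_cases i <;> fin_cases j <;> simp at hij ⊢
  · choose l hl using fun i => hc.exists_linear_form (h i) hV hVc hVt hne
    -- If two of the forms were dependent, the corresponding wedge, and with it the third partial
    -- derivative, would vanish on all of V.
    have hind : ∀ i j, i ≠ j → l i (1, 0) * l j (0, 1) - l i (0, 1) * l j (1, 0) ≠ 0 := by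
      intro i j hij h0
      obtain ⟨k, hk⟩ := exists_third_index hij
      obtain ⟨q, hq, hg⟩ := hc.exists_grad_ne_zero hV hVt hne k
      have hw := hc.wedge (hVt hq) k (1, 0) (0, 1)
      obtain ⟨ρ, -, hρ⟩ := hl (k + 1) q hq
      obtain ⟨ρ', -, hρ'⟩ := hl (k + 2) q hq
      simp only [hρ, hρ', mul_one, mul_zero, sub_zero, one_mul] at hw
      apply hg
      rw [← hw]
      rcases hk with ⟨rfl, rfl⟩ | ⟨rfl, rfl⟩
      · linear_combination ρ * ρ' * h0
      · linear_combination -ρ * ρ' * h0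
    refine ⟨l, fun i => ⟨?_, fun q hq hfol => ?_⟩, fun i j hij =>
      linearIndependent_pair_of_wedge (hind i j hij)⟩
    · intro h0
      have := hind i (i + 1) (by clear * -; revert i; decide)
      simp [h0] at this
    · obtain ⟨ρ, -, hρ⟩ := hl i q hq
      refine c.comap_foliation_eq (hVt hq) i (r := ρ) ?_ hρ
      rintro rfl
      exact hfol (hc.foliation_eq_tangent (hVt hq) i fun x => by rw [hρ, zero_mul])

end Propagation

/-! ### Determination of the parameters -/

section Parameters

variable {a : Fin 4 → ℂ}

theorem coeffs_eq_zero_of_eventually {x₀ A B C : ℂ}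
    (h : ∀ᶠ x in 𝓝 x₀, A * x ^ 2 + B * x + C = 0) : A = 0 ∧ B = 0 ∧ C = 0 := by
  let P : Polynomial ℂ := .C A * .X ^ 2 + .C B * .X + .C C
  have hP : P = 0 := by
    refine Polynomial.eq_zero_of_infinite_isRoot _ ((infinite_of_mem_nhds x₀ h).mono fun x hx => ?_)
    simpa [P, Polynomial.IsRoot] using hx
  have h0 := congrArg (fun R => Polynomial.coeff R 0) hP
  have h1 := congrArg (fun R => Polynomial.coeff R 1) hP
  have h2 := congrArg (fun R => Polynomial.coeff R 2) hP
  simp [P, Polynomial.coeff_X, Polynomial.coeff_C] at h0 h1 h2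
  exact ⟨h2, h1, h0⟩

/-- Coefficient comparison: x²y² gives K = 1, xy gives a₂ = 0, the linear terms give a₁ = a₀ = 0,
and the constant term gives 4a₃ = 16. -/
theorem coeffs_of_eventually_biquadratic {w : ℂ × ℂ} {K : ℂ}
    (h : ∀ᶠ x : ℂ × ℂ in 𝓝 w, (x.1 * x.2 - a 2) ^ 2 -
      4 * (x.1 ^ 2 + x.2 ^ 2 - a 0 * x.1 - a 1 * x.2 - a 3) = K * (x.1 ^ 2 - 4) * (x.2 ^ 2 - 4)) :
    a = ![0, 0, 0, 4] := by
  obtain ⟨w₁, w₂⟩ := w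
  rw [nhds_prod_eq] at h
  have h1 : ∀ᶠ x in 𝓝 w₁, x ^ 2 - 4 - K * (x ^ 2 - 4) = 0 ∧ -2 * a 2 * x + 4 * a 1 = 0 ∧
      a 2 ^ 2 - 4 * x ^ 2 + 4 * a 0 * x + 4 * a 3 + 4 * K * (x ^ 2 - 4) = 0 := by
    filter_upwards [h.curry] with x hx
    refine coeffs_eq_zero_of_eventually (x₀ := w₂) ?_
    filter_upwards [hx] with y hy
    linear_combination hy
  obtain ⟨e1, -, -⟩ := coeffs_eq_zero_of_eventually (x₀ := w₁) (A := 1 - K) (B := 0)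
    (C := -4 + 4 * K) (by filter_upwards [h1] with x hx; linear_combination hx.1)
  obtain ⟨-, e2, e3⟩ := coeffs_eq_zero_of_eventually (x₀ := w₁) (A := 0) (B := -2 * a 2)
    (C := 4 * a 1) (by filter_upwards [h1] with x hx; linear_combination hx.2.1)
  obtain ⟨-, e4, e5⟩ := coeffs_eq_zero_of_eventually (x₀ := w₁) (A := -4 + 4 * K) (B := 4 * a 0)
    (C := a 2 ^ 2 + 4 * a 3 - 16 * K) (by filter_upwards [h1] with x hx; linear_combination hx.2.2)
  have ha2 : a 2 = 0 := by linear_combination (-1 / 2 : ℂ) * e2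
  funext j
  fin_cases j
  · change a 0 = 0; linear_combination (1 / 4 : ℂ) * e4
  · change a 1 = 0; linear_combination (1 / 4 : ℂ) * e3
  · exact ha2
  · change a 3 = 4; linear_combination (1 / 4 : ℂ) * e5 - 4 * e1 - (1 / 4 : ℂ) * a 2 * ha2

/-- On the surface P₂² equals the discriminant of the cubic as a quadratic polynomial in x₂. The
wedge formula gives P₂ = ρ₀ρ₁ (l₀ ∧ l₁), whose square is a constant times (x₀² - 4)(x₁² - 4). -/
theorem HolChart.IsSymplectic.parameters_eq {c : HolChart a} (hc : c.IsSymplectic)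
    (h : ∀ i, ∀ q ∈ c.toHomeo.target, c.HasConstDiff i q) (hne : c.toHomeo.target.Nonempty) :
    a = ![0, 0, 0, 4] := by
  obtain ⟨q, hq, hg⟩ := hc.exists_grad_ne_zero c.toHomeo.open_target subset_rfl hne 2
  obtain ⟨r, hr, hball⟩ := Metric.isOpen_iff.mp c.toHomeo.open_target q hq
  have hform := fun i => hc.exists_linear_form (h i) Metric.isOpen_ball
    (convex_ball q r).isPreconnected hball ⟨q, Metric.mem_ball_self hr⟩
  obtain ⟨l₀, hl₀⟩ := hform 0
  obtain ⟨l₁, hl₁⟩ := hform 1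
  let Φ : ℂ × ℂ → ℂ × ℂ := fun q => (c.coord 0 q, c.coord 1 q)
  have hw : ∀ q ∈ c.toHomeo.target, ∀ x y, fderiv ℂ (c.coord 0) q x * fderiv ℂ (c.coord 1) q y -
      fderiv ℂ (c.coord 1) q x * fderiv ℂ (c.coord 0) q y =
      (x.1 * y.2 - x.2 * y.1) * grad a (c.param q) 2 := fun q hq x y => by
    simpa using hc.wedge hq 2 x y
  have hrel : ∀ᶠ q' in 𝓝 q, ((Φ q').1 * (Φ q').2 - a 2) ^ 2 -
      4 * ((Φ q').1 ^ 2 + (Φ q').2 ^ 2 - a 0 * (Φ q').1 - a 1 * (Φ q').2 - a 3) =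
      (l₀ (1, 0) * l₁ (0, 1) - l₀ (0, 1) * l₁ (1, 0)) ^ 2 * ((Φ q').1 ^ 2 - 4)
        * ((Φ q').2 ^ 2 - 4) := by
    filter_upwards [Metric.ball_mem_nhds q hr] with q' hq'
    obtain ⟨ρ₀, e0, hρ₀⟩ := hl₀ q' hq'
    obtain ⟨ρ₁, e1, hρ₁⟩ := hl₁ q' hq'
    have hw' := hw q' (hball hq') (1, 0) (0, 1)
    have hcub := c.cubic_param q'
    simp only [hρ₀, hρ₁, mul_one, mul_zero, sub_zero, one_mul] at hw'
    simp only [Φ, ← e0, ← e1]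
    have hg2 : grad a (c.param q') 2 = 2 * c.coord 2 q' + c.coord 0 q' * c.coord 1 q' - a 2 := rfl
    have hc2 : c.coord 0 q' ^ 2 + c.coord 1 q' ^ 2 + c.coord 2 q' ^ 2 +
      c.coord 0 q' * c.coord 1 q' * c.coord 2 q' - (a 0 * c.coord 0 q' + a 1 * c.coord 1 q' +
      a 2 * c.coord 2 q' + a 3) = 0 := hcub
    rw [hg2] at hw'
    linear_combination -4 * hc2 - (2 * c.coord 2 q' + c.coord 0 q' * c.coord 1 q' - a 2 +
      ρ₀ * ρ₁ * (l₀ (1, 0) * l₁ (0, 1) - l₀ (0, 1) * l₁ (1, 0))) * hw'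
  have hstrict : HasStrictFDerivAt Φ ((fderiv ℂ (c.coord 0) q).prod (fderiv ℂ (c.coord 1) q)) q :=
    (c.analyticOnNhd_coord 0 q hq).hasStrictFDerivAt.prodMk
      (c.analyticOnNhd_coord 1 q hq).hasStrictFDerivAt
  have hsurj : ((fderiv ℂ (c.coord 0) q).prod (fderiv ℂ (c.coord 1) q)).range = ⊤ := by
    rw [LinearMap.range_eq_top]
    refine LinearMap.surjective_of_injective ?_
    rw [← LinearMap.ker_eq_bot, LinearMap.ker_eq_bot']
    intro x hx
    have h0 : fderiv ℂ (c.coord 0) q x = 0 := congrArg Prod.fst hx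
    have h1 : fderiv ℂ (c.coord 1) q x = 0 := congrArg Prod.snd hx
    have w1 := hw q hq x (1, 0)
    have w2 := hw q hq x (0, 1)
    simp only [h0, h1, zero_mul, sub_zero, mul_zero, mul_one, zero_sub] at w1 w2
    ext
    · simpa [hg] using w2.symm
    · simpa [hg] using w1.symm
  -- At q the Jacobian P₂ of (x₀, x₁) is non-zero, so this map sends neighbourhoods onto
  -- neighbourhoods, and the relation holds on an open set of ℂ² as an identity in independent
  -- variables.
  have hmap := hstrict.map_nhds_eq_of_surj hsurj
  refine coeffs_of_eventually_biquadratic (w := Φ q)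
    (K := (l₀ (1, 0) * l₁ (0, 1) - l₀ (0, 1) * l₁ (1, 0)) ^ 2) ?_
  rw [← hmap]
  exact hrel

end Parameters

/-! ### The web of the Cayley cubic is parallelizable -/

section Cayley

/-- The parametrization `(u, v) ↦ (2 cos u, 2 cos v, -2 cos (u + v))` of the Cayley cubic. -/
noncomputable def cosPt (q : ℂ × ℂ) : Fin 3 → ℂ :=
  ![2 * Complex.cos q.1, 2 * Complex.cos q.2, -2 * Complex.cos (q.1 + q.2)]

theorem cosPt_mem (q : ℂ × ℂ) : cosPt q ∈ surface ![0, 0, 0, 4] := by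
  change cubic _ _ = 0
  have h1 := Complex.sin_sq_add_cos_sq q.1
  have h2 := Complex.sin_sq_add_cos_sq q.2
  simp [cubic, cosPt, Complex.cos_add]
  linear_combination 4 * Complex.sin q.2 ^ 2 * h1 + 4 * (1 - Complex.cos q.1 ^ 2) * h2

theorem grad_two_cosPt (q : ℂ × ℂ) :
    grad ![0, 0, 0, 4] (cosPt q) 2 = 4 * Complex.sin q.1 * Complex.sin q.2 := by
  simp [grad, cosPt, Complex.cos_add]
  ring

theorem grad_zero_cosPt (q : ℂ × ℂ) :
    grad ![0, 0, 0, 4] (cosPt q) 0 = 4 * Complex.sin q.2 * Complex.sin (q.1 + q.2) := by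
  have h2 := Complex.sin_sq_add_cos_sq q.2
  simp [grad, cosPt, Complex.cos_add, Complex.sin_add]
  linear_combination -4 * Complex.cos q.1 * h2

/-- The differential of `cosPt`. -/
noncomputable def cosPtDeriv (q : ℂ × ℂ) : Fin 3 → (ℂ × ℂ →L[ℂ] ℂ) :=
  ![(-2 * Complex.sin q.1) • ContinuousLinearMap.fst ℂ ℂ ℂ,
    (-2 * Complex.sin q.2) • ContinuousLinearMap.snd ℂ ℂ ℂ,
    (2 * Complex.sin (q.1 + q.2)) •
      (ContinuousLinearMap.fst ℂ ℂ ℂ + ContinuousLinearMap.snd ℂ ℂ ℂ)]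

theorem hasFDerivAt_cosPt (q : ℂ × ℂ) :
    HasFDerivAt cosPt (ContinuousLinearMap.pi (cosPtDeriv q)) q := by
  have d1 : HasFDerivAt (fun q : ℂ × ℂ => q.1) (ContinuousLinearMap.fst ℂ ℂ ℂ) q := hasFDerivAt_fst
  have d2 : HasFDerivAt (fun q : ℂ × ℂ => q.2) (ContinuousLinearMap.snd ℂ ℂ ℂ) q := hasFDerivAt_snd
  refine hasFDerivAt_pi.mpr fun j => ?_
  fin_cases j
  · refine (d1.ccos.const_mul 2).congr_fderiv ?_
    ext <;> simp [cosPtDeriv]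
  · refine (d2.ccos.const_mul 2).congr_fderiv ?_
    ext <;> simp [cosPtDeriv]
  · refine ((d1.add d2).ccos.const_mul (-2)).congr_fderiv ?_
    ext <;> simp [cosPtDeriv]

/-- For x₀ = 2 cos u and x₁ = 2 cos v the cubic, as a quadratic in x₂, has the roots -2 cos (u + v)
and -2 cos (u - v). The second is reached by replacing v with -v. -/
theorem exists_eq_cosPt {x : Fin 3 → ℂ} (hx : x ∈ surface ![0, 0, 0, 4]) : ∃ q, x = cosPt q := by
  obtain ⟨u, hu⟩ := Complex.cos_surjective (x 0 / 2)
  obtain ⟨v, hv⟩ := Complex.cos_surjective (x 1 / 2)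
  have h0 : x 0 = 2 * Complex.cos u := by rw [hu]; ring
  have h1 : x 1 = 2 * Complex.cos v := by rw [hv]; ring
  have hc : cubic ![0, 0, 0, 4] x = 0 := hx
  have e1 := Complex.sin_sq_add_cos_sq u
  have e2 := Complex.sin_sq_add_cos_sq v
  have hfac : (x 2 + 2 * Complex.cos (u + v)) * (x 2 + 2 * Complex.cos (u - v)) = 0 := by
    simp only [cubic, h0, h1] at hc
    simp at hc
    rw [Complex.cos_add, Complex.cos_sub]
    linear_combination hc - 4 * Complex.sin v ^ 2 * e1 - 4 * (1 - Complex.cos u ^ 2) * e2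
  rcases mul_eq_zero.mp hfac with h | h
  · refine ⟨(u, v), ?_⟩
    funext j
    fin_cases j
    · simpa [cosPt] using h0
    · simpa [cosPt] using h1
    · simp [cosPt]; linear_combination h
  · refine ⟨(u, -v), ?_⟩
    funext j
    fin_cases j
    · simpa [cosPt] using h0
    · simpa [cosPt] using h1
    · simp [cosPt, ← sub_eq_add_neg]; linear_combination h

theorem exists_openPartialHomeomorph_cos {u : ℂ} (hu : Complex.sin u ≠ 0) :
    ∃ e : OpenPartialHomeomorph ℂ ℂ, u ∈ e.source ∧ ∀ x, e x = 2 * Complex.cos x := by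
  have hd : HasStrictDerivAt (fun x => 2 * Complex.cos x) (2 * -Complex.sin u) u :=
    (Complex.hasStrictDerivAt_cos u).const_mul 2
  have hf := hd.hasStrictFDerivAt_equiv (by simpa using hu)
  exact ⟨hf.toOpenPartialHomeomorph _, hf.mem_toOpenPartialHomeomorph_source, fun x => rfl⟩

/-- The parameters at which the three foliations of the Cayley cubic are pairwise transversal. -/
def cosRegular : Set (ℂ × ℂ) :=
  {q | Complex.sin q.1 ≠ 0 ∧ Complex.sin q.2 ≠ 0 ∧ Complex.sin (q.1 + q.2) ≠ 0}

theorem isOpen_cosRegular : IsOpen cosRegular := by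
  refine IsOpen.inter ?_ (IsOpen.inter ?_ ?_)
  all_goals exact isOpen_ne_fun (by fun_prop) continuous_const

/-- Two values of x₂ over the same (x₀, x₁) are equal or are the two roots of a quadratic with sum
-x₀x₁; the inequation rules out the second case. -/
theorem third_coord_eq {x : Fin 3 → ℂ} (hx : x ∈ surface ![0, 0, 0, 4]) {q : ℂ × ℂ}
    (h0 : x 0 = cosPt q 0) (h1 : x 1 = cosPt q 1) (h2 : x 2 + cosPt q 2 + x 0 * x 1 ≠ 0) :
    x 2 = cosPt q 2 := by
  have e1 : cubic ![0, 0, 0, 4] x = 0 := hx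
  have e2 : cubic ![0, 0, 0, 4] (cosPt q) = 0 := cosPt_mem q
  rw [h0, h1] at h2
  simp only [cubic, h0, h1] at e1 e2
  have h3 : (x 2 - cosPt q 2) * (x 2 + cosPt q 2 + cosPt q 0 * cosPt q 1) = 0 := by
    simp at e1 e2
    linear_combination e1 - e2
  exact sub_eq_zero.mp ((mul_eq_zero.mp h3).resolve_right h2)

/-- A local inverse of `cosPt`, built from local inverses `E` of `(u, v) ↦ (2 cos u, 2 cos v)`. -/
noncomputable def cosHomeo (E : OpenPartialHomeomorph (ℂ × ℂ) (ℂ × ℂ))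
    (hE : ∀ q, E q = (cosPt q 0, cosPt q 1)) :
    OpenPartialHomeomorph (surface ![0, 0, 0, 4]) (ℂ × ℂ) where
  toFun p := E.symm (p.1 0, p.1 1)
  invFun q := ⟨cosPt q, cosPt_mem q⟩
  -- The inequation selects the sheet x₂ = -2 cos (u + v) of the double cover (x₀, x₁) by an open
  -- condition.
  source := {p | (p.1 0, p.1 1) ∈ E.target ∧
    (p.1 2 + cosPt (E.symm (p.1 0, p.1 1)) 2 + p.1 0 * p.1 1 ≠ 0 ∧
      E.symm (p.1 0, p.1 1) ∈ cosRegular)}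
  target := E.source ∩ cosRegular
  map_source' p hp := ⟨E.map_target hp.1, hp.2.2⟩
  map_target' q hq := by
    have h : E.symm (cosPt q 0, cosPt q 1) = q := by rw [← hE, E.left_inv hq.1]
    refine ⟨by rw [← hE]; exact E.map_source hq.1, ?_, by rw [h]; exact hq.2⟩
    have hg := grad_two_cosPt q
    simp only [h]
    intro h0
    have h2 : 4 * Complex.sin q.1 * Complex.sin q.2 = 0 := by
      rw [← hg]
      simp [grad]
      linear_combination h0
    exact mul_ne_zero (mul_ne_zero (by norm_num) hq.2.1) hq.2.2.1 h2
  left_inv' p hp := by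
    have h := E.right_inv hp.1
    rw [hE] at h
    have h0 := congrArg Prod.fst h
    have h1 := congrArg Prod.snd h
    simp only at h0 h1
    have h2 := third_coord_eq p.2 h0.symm h1.symm hp.2.1
    refine Subtype.ext (funext fun j => ?_)
    fin_cases j
    · exact h0
    · exact h1
    · exact h2.symm
  right_inv' q hq := by
    change E.symm (cosPt q 0, cosPt q 1) = q
    rw [← hE, E.left_inv hq.1]
  open_source := by
    have hcoord : ∀ k, Continuous fun p : surface ![0, 0, 0, 4] => p.1 k := fun k =>
      (continuous_apply k).comp continuous_subtype_val
    have hpair : Continuous fun p : surface ![0, 0, 0, 4] => (p.1 0, p.1 1) :=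
      (hcoord 0).prodMk (hcoord 1)
    have hcont : ContinuousOn (fun p : surface ![0, 0, 0, 4] => E.symm (p.1 0, p.1 1))
        {p | (p.1 0, p.1 1) ∈ E.target} :=
      E.continuousOn_symm.comp hpair.continuousOn fun p hp => hp
    have hcos : Continuous cosPt :=
      continuous_iff_continuousAt.mpr fun q => (hasFDerivAt_cosPt q).continuousAt
    have hcont2 : ContinuousOn (fun p : surface ![0, 0, 0, 4] =>
        (p.1 2 + cosPt (E.symm (p.1 0, p.1 1)) 2 + p.1 0 * p.1 1, E.symm (p.1 0, p.1 1)))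
        {p | (p.1 0, p.1 1) ∈ E.target} :=
      ((((hcoord 2).continuousOn).add (((continuous_apply 2).comp hcos).comp_continuousOn hcont)).add
        ((hcoord 0).mul (hcoord 1)).continuousOn).prodMk hcont
    exact hcont2.isOpen_inter_preimage (E.open_target.preimage hpair)
      (isOpen_ne.prod isOpen_cosRegular)
  open_target := E.open_source.inter isOpen_cosRegular
  continuousOn_toFun := by
    have hpair : Continuous fun p : surface ![0, 0, 0, 4] => (p.1 0, p.1 1) :=
      ((continuous_apply 0).comp continuous_subtype_val).prodMk
        ((continuous_apply 1).comp continuous_subtype_val)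
    exact E.continuousOn_symm.comp hpair.continuousOn fun p hp => hp.1
  continuousOn_invFun := by
    have hcos : Continuous cosPt :=
      continuous_iff_continuousAt.mpr fun q => (hasFDerivAt_cosPt q).continuousAt
    exact (hcos.subtype_mk _).continuousOn

/-- The holomorphic chart of the Cayley cubic given by `cosHomeo`. -/
noncomputable def cosChart (E : OpenPartialHomeomorph (ℂ × ℂ) (ℂ × ℂ))
    (hE : ∀ q, E q = (cosPt q 0, cosPt q 1)) : HolChart ![0, 0, 0, 4] where
  toHomeo := cosHomeo E hE
  smooth p hp := by
    intro h
    have h1 : cosPt (E.symm (p.1 0, p.1 1)) = p.1 :=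
      congrArg Subtype.val ((cosHomeo E hE).left_inv hp)
    have h2 := grad_two_cosPt (E.symm (p.1 0, p.1 1))
    rw [h1, h] at h2
    exact mul_ne_zero (mul_ne_zero (by norm_num) hp.2.2.1) hp.2.2.2.1 h2.symm
  holomorphic q _ := (hasFDerivAt_cosPt q).differentiableAt.differentiableWithinAt
  immersion q hq := by
    have hd : fderiv ℂ (fun q => ((cosHomeo E hE).symm q : Fin 3 → ℂ)) q =
        ContinuousLinearMap.pi (cosPtDeriv q) := (hasFDerivAt_cosPt q).fderiv
    rw [hd]
    intro x y hxy
    have h0 := congrFun hxy 0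
    have h1 := congrFun hxy 1
    have s1 : Complex.sin q.1 ≠ 0 := hq.2.1
    have s2 : Complex.sin q.2 ≠ 0 := hq.2.2.1
    ext
    · simpa [cosPtDeriv, s1] using h0
    · simpa [cosPtDeriv, s2] using h1

/-- If Pₖ = 0, the k-th basis vector is tangent and is killed by the differentials of the two other
coordinates, so two of the foliations share a direction. -/
theorem grad_ne_zero_of_isWebRegular {a : Fin 4 → ℂ} {p : surface a} (hp : IsWebRegular a p)
    (k : Fin 3) : grad a p k ≠ 0 := by
  intro h
  have hij := hp.2 (k + 1) (k + 2) (by clear * -; revert k; decide)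
  have hmem : cyclicVec k 1 0 0 ∈ foliation a (k + 1) p ⊓ foliation a (k + 2) p := by
    have ht : cyclicVec k 1 0 0 ∈ tangent a (p : Fin 3 → ℂ) := by
      rw [mem_tangent_iff _ _ k, h]
      simp
    exact ⟨⟨ht, by simp⟩, ⟨ht, by simp⟩⟩
  rw [hij, Submodule.mem_bot] at hmem
  have := congrFun hmem k
  simp at this

/-- In the coordinates (u, v) of `cosPt`, the functions xᵢ depend only on u, v and u + v
respectively. Regularity of the web makes P₂ = 4 sin u sin v and P₀ = 4 sin v sin (u + v) non-zero,
so (u, v) are local coordinates and no dxᵢ vanishes. -/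
theorem webLocallyParallelizable_cayley : WebLocallyParallelizable ![0, 0, 0, 4] := by
  intro p hp
  obtain ⟨q₀, hq₀⟩ := exists_eq_cosPt p.2
  have g2 := grad_ne_zero_of_isWebRegular hp 2
  have g0 := grad_ne_zero_of_isWebRegular hp 0
  rw [hq₀, grad_two_cosPt] at g2
  rw [hq₀, grad_zero_cosPt] at g0
  have s1 : Complex.sin q₀.1 ≠ 0 := right_ne_zero_of_mul (left_ne_zero_of_mul g2)
  have s2 : Complex.sin q₀.2 ≠ 0 := right_ne_zero_of_mul g2
  have s3 : Complex.sin (q₀.1 + q₀.2) ≠ 0 := right_ne_zero_of_mul g0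
  obtain ⟨e₁, h₁, he₁⟩ := exists_openPartialHomeomorph_cos s1
  obtain ⟨e₂, h₂, he₂⟩ := exists_openPartialHomeomorph_cos s2
  have hE : ∀ q, (e₁.prod e₂) q = (cosPt q 0, cosPt q 1) := fun q => by
    simp [he₁, he₂, cosPt]
  have hmem : q₀ ∈ (cosHomeo _ hE).target := ⟨⟨h₁, h₂⟩, s1, s2, s3⟩
  have hpe : p = (cosHomeo _ hE).symm q₀ := Subtype.ext hq₀
  refine ⟨cosChart _ hE, by rw [hpe]; exact (cosHomeo _ hE).map_target hmem, ?_⟩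
  refine ⟨![LinearMap.fst ℂ ℂ ℂ, LinearMap.snd ℂ ℂ ℂ, LinearMap.fst ℂ ℂ ℂ + LinearMap.snd ℂ ℂ ℂ],
    fun i => ⟨?_, fun q hq _ => ?_⟩, fun i j hij => ?_⟩
  · intro h0
    have h1 := LinearMap.congr_fun h0 (1, 0)
    have h2 := LinearMap.congr_fun h0 (0, 1)
    fin_cases i <;> simp at h1 h2
  · have hd : ∀ j, fderiv ℂ ((cosChart _ hE).coord j) q = cosPtDeriv q j := fun j =>
      (hasFDerivAt_pi.mp (hasFDerivAt_cosPt q) j).fderiv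
    have hr : q ∈ cosRegular := hq.2
    obtain ⟨r1, r2, r3⟩ := hr
    refine (cosChart _ hE).comap_foliation_eq hq i (r := ![-2 * Complex.sin q.1,
      -2 * Complex.sin q.2, 2 * Complex.sin (q.1 + q.2)] i) ?_ fun x => ?_
    · fin_cases i <;> simp [r1, r2, r3]
    · rw [hd]
      fin_cases i <;> simp [cosPtDeriv, mul_add]
  · apply linearIndependent_pair_of_wedge (x := (1, 0)) (y := (0, 1))
    fin_cases i <;> fin_cases j <;> simp at hij ⊢

end Cayley

end CubicWeb

theorem mainTheorem3 (a : Fin 4 → ℂ) (U : Set (CubicWeb.surface a))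
    (hU : CubicWeb.IsZariskiOpen a U) (hne : U.Nonempty)
    (A : CubicWeb.AffineStructure a U)
    (G : Subgroup (Equiv.Perm (CubicWeb.surface a)))
    (hG : G ≤ CubicWeb.Gamma2 a) (hfin : G.IsFiniteRelIndex (CubicWeb.Gamma2 a))
    (hinv : A.IsInvariant G) :
    (∀ c ∈ A.atlas, ∀ V ⊆ c.toHomeo.target, IsOpen V → IsPreconnected V → c.IsParallelWeb V) ∧
      CubicWeb.WebLocallyParallelizable a ∧
      a = ![0, 0, 0, 4] := by
  have hconst : ∀ c ∈ A.atlas, ∀ i, ∀ q ∈ c.toHomeo.target, c.HasConstDiff i q :=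
    fun c hc i q hq => hinv.hasConstDiff hfin hU hne i hc hq
  have ha : a = ![0, 0, 0, 4] := by
    obtain ⟨p, -, -, c, hc, hp, -⟩ := hinv.exists_hasConstDiff hfin hU hne 0
    exact (A.symplectic c hc).parameters_eq (hconst c hc) ⟨_, c.toHomeo.map_source hp⟩
  refine ⟨fun c hc V hVt hV hVc => (A.symplectic c hc).isParallelWeb (hconst c hc) hV hVc hVt,
    ?_, ha⟩
  -- The affine charts reach only the smooth points of U, whereas every regular point of the web is
  -- concerned here; the explicit model of the Cayley cubic covers them all.
  rw [ha]
  exact CubicWeb.webLocallyParallelizable_cayley
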